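/- Let $\mathcal X$ be a real Hilbert space and let $g:\mathcal X\to\mathbb R$ be convex and differentiable with $\operatorname{argmin} g\neq\emptyset$. Let $\alpha,\beta,a,t_0>0$, $0<q<1$ and $q<p<q+1$. Let $\delta:[t_0,+\infty)\to(0,+\infty)$ be a non-decreasing differentiable function with $\lim_{t\to+\infty}\delta(t)=+\infty$ such that, for all sufficiently large $t$, $$t^p\dot\delta(t)+p\,t^{p-1}\delta(t)-a\beta\ \ge\ 0,$$ and such that, for some constant $K_1>0$, $t\dot\delta(t)<K_1\delta(t)$ for all sufficiently large $t$. Let $x:[t_0,+\infty)\to\mathcal X$ be a global solution, that is, a twice differentiable trajectory along which $\nabla^2 g$ exists and which satisfies, for all $t\ge t_0$, $$\ddot x(t)+\frac{\alpha}{t^q}\dot x(t)+\beta\nabla^2 g(x(t))\dot x(t)+\delta(t)\nabla g(x(t))+\frac{a}{t^p}x(t)=0 .$$ Then $g$ has a unique minimizer of minimal norm $\bar x^*=\operatorname{proj}_{\operatorname{argmin} g}0$; for every $t\ge t_0$ the function $g_t(z)=g(z)+\frac{a}{2\delta(t)t^p}\|z\|^2$ has a unique minimizer $x_t$ on $\mathcal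 X$; and the following hold. (i) $x(t)$ converges strongly to $\bar x^*$, that is, $\lim_{t\to+\infty}\|x(t)-\bar x^*\|=0$. (ii) If $q<p<\frac12(3q+1)$, then, as $t\to+\infty$, $$\|\dot x(t)+\beta\nabla g(x(t))\|=\mathcal O\!\left(t^{-\frac{p+1-\max\{q,p-q\}}{2}}\right),\qquad \|x(t)-x_t\|=\mathcal O\!\left(t^{-\frac{1-q}{2}}\right),\qquad g(x(t))-g(\bar x^*)=\mathcal O\!\left(\frac{1}{\delta(t)t^p}\right).$$ (iii) If $\frac12(3q+1)\le p<q+1$, then, as $t\to+\infty$, $$\|\dot x(t)+\beta\nabla g(x(t))\|=\mathcal O\!\left(\frac1{t^{2q-p+1}}\right),\qquad \|x(t)-x_t\|=\mathcal O\!\left(\frac1{t^{q-p+1}}\right).$$ If moreover $p\le\frac13(4q+2)$, then $g(x(t))-g(\bar x^*)=\mathcal O\!\left(\frac{1}{\delta(t)t^p}\right)$; if instead $\frac13(4q+2)<p<q+1$, then $g(x(t))-g(\bar x^*)=\mathcal O\!\left(\frac{1}{\delta(t)t^{4q-2p+2}}\right)$. -/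

import Mathlib

open Set Filter Topology Asymptotics

noncomputable section

namespace TikhonovHessian

/-- Time derivative on the half-line `[t₀, +∞)` (one-sided at the initial time `t₀`). -/
def timeDeriv {E : Type*} [NormedAddCommGroup E] [NormedSpace ℝ E]
    (t₀ : ℝ) (f : ℝ → E) (t : ℝ) : E :=
  derivWithin f (Ici t₀) t

variable {X : Type*} [NormedAddCommGroup X] [InnerProductSpace ℝ X] [CompleteSpace X]

/-- The Hessian of `g` at `z`: the Fréchet derivative at `z` of the gradient map. -/
def hessian (g : X → ℝ) (z : X) : X →L[ℝ] X :=
  fderiv ℝ (gradient g) z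

/-- `x` is a global solution on `[t₀, +∞)` of
`x'' + (α / t^q) x' + β ∇²g(x) x' + δ(t) ∇g(x) + (a / t^p) x = 0`.
The trajectory is twice differentiable, and the Hessian in the equation exists along it. -/
structure IsGlobalSolution (g : X → ℝ) (α β a p q t₀ : ℝ) (δ : ℝ → ℝ) (x : ℝ → X) : Prop where
  differentiable : DifferentiableOn ℝ x (Ici t₀)
  differentiable_velocity : DifferentiableOn ℝ (timeDeriv t₀ x) (Ici t₀)
  differentiable_gradient : ∀ t, t₀ ≤ t → DifferentiableAt ℝ (gradient g) (x t)
  equation : ∀ t, t₀ ≤ t →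
    timeDeriv t₀ (timeDeriv t₀ x) t + (α / t ^ q) • timeDeriv t₀ x t
      + β • hessian g (x t) (timeDeriv t₀ x t)
      + δ t • gradient g (x t) + (a / t ^ p) • x t = 0

/-- The set of global minimizers of `g`. -/
def argmin {Y : Type*} (g : Y → ℝ) : Set Y :=
  {z | ∀ y, g z ≤ g y}

/-- `z` is an element of minimal norm of `argmin g`, that is, the projection of `0` onto it. -/
def IsMinNormMinimizer (g : X → ℝ) (z : X) : Prop :=
  z ∈ argmin g ∧ ∀ y ∈ argmin g, ‖z‖ ≤ ‖y‖

/-- The Tikhonov regularized function `g_t(z) = g(z) + a / (2 δ(t) t^p) * ‖z‖²`. -/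
def regularized (g : X → ℝ) (a p : ℝ) (δ : ℝ → ℝ) (t : ℝ) (z : X) : ℝ :=
  g z + a / (2 * δ t * t ^ p) * ‖z‖ ^ 2

end TikhonovHessian

end

/-!
Write `g_ε = g + (ε / 2) ‖·‖²`, let `z(ε)` be its minimizer, and put `ε(t) = a / (δ(t) t^p)` and
`γ(t) = α / t^q`. In terms of the shifted velocity `v = x' + β ∇g(x)` the Hessian disappears from
the equation, which becomes `v' = -γ x' - δ ∇g_ε(x)`, and the energy
`E = δ (g_ε(x) - g_ε(z(ε))) + ¼ ‖v‖² + ¼ ‖v + γ (x - z(ε))‖²` satisfies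
`E' ≤ -c t^(-max q (p - q)) E + C t^(-min (p + 1) (3 q + 2 - p))`, whence `E = O(t^(-k))` with `k`
the difference of the two exponents. As `t ↦ z(ε(t))` need not be differentiable, `E'` is a lower
Dini derivative, bounded by the derivative of a majorant that touches `E` at the given time; the
growth condition on `δ` makes `ε` eventually nonincreasing, which the majorant requires.

The energy controls `‖v‖²` and `δ (g(x) - min g)`, and it controls `‖x - z(ε)‖` both through
`γ² ‖x - z(ε)‖² ≤ 8 E` and through the strong convexity bound `δ ε ‖x - z(ε)‖² ≤ 2 E`; the better of
the two always tends to `0`, while `z(ε)` tends to the minimizer of `g` of minimal norm.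
-/

namespace TikhonovHessian

section StrongConvexity

variable {E : Type*} [NormedAddCommGroup E] [NormedSpace ℝ E] {f : E → ℝ} {m : ℝ}

theorem isClosed_argmin {Y : Type*} [TopologicalSpace Y] {f : Y → ℝ} (hf : Continuous f) :
    IsClosed (argmin f) := by
  simp only [argmin, ofPred_forall]
  exact isClosed_iInter fun y => isClosed_le hf continuous_const

theorem convex_argmin (hf : ConvexOn ℝ univ f) : Convex ℝ (argmin f) := by
  simp only [argmin, ofPred_forall]
  exact convex_iInter fun y => by simpa using hf.convex_le (f y)

theorem add_norm_sub_sq_le_of_mem_argmin (hf : StrongConvexOn univ m f) {z : E}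
    (hz : z ∈ argmin f) (u : E) : f z + m / 2 * ‖u - z‖ ^ 2 ≤ f u := by
  have on_segment : ∀ s ∈ Ioo (0 : ℝ) 1, f z + (1 - s) * (m / 2 * ‖u - z‖ ^ 2) ≤ f u := by
    rintro s ⟨hs0, hs1⟩
    have hmin := hz ((1 - s) • z + s • u)
    have hconv := hf.2 (mem_univ z) (mem_univ u) (sub_nonneg.2 hs1.le) hs0.le (by ring)
    rw [norm_sub_rev z u, smul_eq_mul, smul_eq_mul] at hconv
    refine le_of_mul_le_mul_left ?_ hs0
    linarith
  have hlim : Tendsto (fun s : ℝ => f z + (1 - s) * (m / 2 * ‖u - z‖ ^ 2)) (𝓝[>] 0)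
      (𝓝 (f z + (1 - 0) * (m / 2 * ‖u - z‖ ^ 2))) :=
    ((continuous_const.add ((continuous_const.sub continuous_id).mul
      continuous_const)).tendsto 0).mono_left nhdsWithin_le_nhds
  rw [sub_zero, one_mul] at hlim
  exact le_of_tendsto hlim (mem_of_superset (Ioo_mem_nhdsGT zero_lt_one) on_segment)

theorem mul_norm_sub_sq_le_of_forall_le (hf : StrongConvexOn univ m f) {c : ℝ}
    (hc : ∀ u, c ≤ f u) (u w : E) : m / 4 * ‖u - w‖ ^ 2 ≤ (f u - c) + (f w - c) := by
  have hconv := hf.2 (mem_univ u) (mem_univ w) (show (0 : ℝ) ≤ 1 / 2 by norm_num)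
    (show (0 : ℝ) ≤ 1 / 2 by norm_num) (by norm_num)
  rw [smul_eq_mul, smul_eq_mul] at hconv
  linarith [hc ((1 / 2 : ℝ) • u + (1 / 2 : ℝ) • w)]

theorem argmin_nonempty_of_strongConvexOn [CompleteSpace E] (hm : 0 < m)
    (hf : StrongConvexOn univ m f) (hcont : Continuous f) (hbdd : BddBelow (range f)) :
    (argmin f).Nonempty := by
  have hinf : ∀ u, ⨅ v, f v ≤ f u := ciInf_le hbdd
  choose u hu using fun n : ℕ => exists_lt_of_ciInf_lt
    (lt_add_of_pos_right (⨅ v, f v) (Nat.one_div_pos_of_nat (α := ℝ) (n := n)))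
  have hgap : Tendsto (fun n : ℕ => 1 / ((n : ℝ) + 1)) atTop (𝓝 0) :=
    tendsto_one_div_add_atTop_nhds_zero_nat
  have hcauchy : CauchySeq u := by
    refine Metric.cauchySeq_iff'.2 fun e he => ?_
    obtain ⟨N, hN⟩ := (hgap.eventually_lt_const (show 0 < m / 8 * e ^ 2 by positivity)).exists
    refine ⟨N, fun n hn => ?_⟩
    have hnN := Nat.one_div_le_one_div (α := ℝ) hn
    have hclose := mul_norm_sub_sq_le_of_forall_le hf hinf (u n) (u N)
    rw [dist_eq_norm]
    refine lt_of_pow_lt_pow_left₀ 2 he.le (lt_of_mul_lt_mul_left ?_ (by positivity : 0 ≤ m / 4))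
    linarith [hu n, hu N]
  obtain ⟨z, hz⟩ := cauchySeq_tendsto_of_complete hcauchy
  refine ⟨z, fun w => le_trans ?_ (hinf w)⟩
  have hupper := tendsto_const_nhds (x := ⨅ v, f v) |>.add hgap
  rw [add_zero] at hupper
  exact le_of_tendsto_of_tendsto' ((hcont.tendsto z).comp hz) hupper fun n => (hu n).le

theorem eq_of_mem_argmin_of_strongConvexOn (hm : 0 < m) (hf : StrongConvexOn univ m f) {z u : E}
    (hz : z ∈ argmin f) (hu : u ∈ argmin f) : z = u :=
  (hf.strictConvexOn hm).eq_of_isMinOn (isMinOn_univ_iff.2 hz) (isMinOn_univ_iff.2 hu)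
    (mem_univ z) (mem_univ u)

end StrongConvexity

section ConvexFunction

variable {X : Type*} [NormedAddCommGroup X] [InnerProductSpace ℝ X] {g : X → ℝ}

theorem IsMinNormMinimizer.eq (hg : ConvexOn ℝ univ g) {z u : X}
    (hz : IsMinNormMinimizer g z) (hu : IsMinNormMinimizer g u) : z = u := by
  by_contra hne
  have hmid := convex_argmin hg hz.1 hu.1 one_half_pos.le one_half_pos.le (add_halves (1 : ℝ))
  exact (norm_combo_lt_of_ne le_rfl (hu.2 z hz.1) hne one_half_pos one_half_pos
    (add_halves 1)).not_ge (hz.2 _ hmid)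

theorem exists_isMinNormMinimizer [CompleteSpace X] (hg : ConvexOn ℝ univ g)
    (hcont : Continuous g) (hne : (argmin g).Nonempty) : ∃ z, IsMinNormMinimizer g z := by
  obtain ⟨z, hz, hdist⟩ := exists_norm_eq_iInf_of_complete_convex hne
    (isClosed_argmin hcont).isComplete (convex_argmin hg) 0
  refine ⟨z, hz, fun y hy => ?_⟩
  calc ‖z‖ = ⨅ w : argmin g, ‖0 - (w : X)‖ := by rw [← hdist, zero_sub, norm_neg]
    _ ≤ ‖0 - y‖ := ciInf_le (f := fun w : argmin g => ‖0 - (w : X)‖)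
      ⟨0, forall_mem_range.2 fun w => norm_nonneg _⟩ ⟨y, hy⟩
    _ = ‖y‖ := by rw [zero_sub, norm_neg]

theorem add_inner_gradient_le [CompleteSpace X] (hg : ConvexOn ℝ univ g)
    (hd : Differentiable ℝ g) (u w : X) : g u + inner ℝ (gradient g u) (w - u) ≤ g w := by
  have hconv : ConvexOn ℝ univ (g ∘ AffineMap.lineMap (k := ℝ) u w) :=
    hg.comp_affineMap (AffineMap.lineMap u w)
  have hderiv : HasDerivAt (g ∘ AffineMap.lineMap (k := ℝ) u w)
      (inner ℝ (gradient g u) (w - u)) 0 := by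
    rw [inner_gradient_left]
    refine HasFDerivAt.comp_hasDerivAt 0 ?_ AffineMap.hasDerivAt_lineMap
    simpa using (hd u).hasFDerivAt
  have hslope := hconv.le_slope_of_hasDerivAt (mem_univ 0) (mem_univ 1) zero_lt_one hderiv
  simp only [slope_def_field, Function.comp, AffineMap.lineMap_apply_one,
    AffineMap.lineMap_apply_zero, sub_zero, div_one] at hslope
  linarith

end ConvexFunction

section TikhonovPath

variable {X : Type*} [NormedAddCommGroup X] [InnerProductSpace ℝ X] {g : X → ℝ}

/-- The Tikhonov regularization of `g` with parameter `ε`. -/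
noncomputable def penalized (g : X → ℝ) (ε : ℝ) (u : X) : ℝ :=
  g u + ε / 2 * ‖u‖ ^ 2

/-- `z` selects, for each positive parameter, a minimizer of the Tikhonov regularization of `g`;
its values at nonpositive parameters are irrelevant. -/
def IsTikhonovPath (g : X → ℝ) (z : ℝ → X) : Prop :=
  ∀ ε, 0 < ε → z ε ∈ argmin (penalized g ε)

theorem strongConvexOn_penalized (hg : ConvexOn ℝ univ g) (ε : ℝ) :
    StrongConvexOn univ ε (penalized g ε) := by
  simpa only [strongConvexOn_iff_convex, penalized, add_sub_cancel_right] using hg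

theorem exists_isTikhonovPath [CompleteSpace X] (hg : ConvexOn ℝ univ g) (hcont : Continuous g)
    (hne : (argmin g).Nonempty) : ∃ z, IsTikhonovPath g z := by
  obtain ⟨y, hy⟩ := hne
  have hmin : ∀ ε, ∃ z, 0 < ε → z ∈ argmin (penalized g ε) := fun ε => by
    by_cases hε : 0 < ε
    · obtain ⟨z, hz⟩ := argmin_nonempty_of_strongConvexOn hε (strongConvexOn_penalized hg ε)
        (by unfold penalized; fun_prop) ⟨g y, forall_mem_range.2 fun u =>
          (hy u).trans (le_add_of_nonneg_right (by positivity))⟩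
      exact ⟨z, fun _ => hz⟩
    · exact ⟨0, fun h => absurd h hε⟩
  choose z hz using hmin
  exact ⟨z, hz⟩

namespace IsTikhonovPath

variable {z : ℝ → X} {ε ε' : ℝ}

theorem norm_le {E : Type*} [NormedAddCommGroup E] {g : E → ℝ} {z : ℝ → E}
    (hz : IsTikhonovPath g z) (hε : 0 < ε) {y : E} (hy : y ∈ argmin g) : ‖z ε‖ ≤ ‖y‖ := by
  have hmin : g (z ε) + ε / 2 * ‖z ε‖ ^ 2 ≤ g y + ε / 2 * ‖y‖ ^ 2 := hz ε hε y
  have hsq : ε / 2 * ‖z ε‖ ^ 2 ≤ ε / 2 * ‖y‖ ^ 2 := by linarith [hy (z ε)]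
  exact (sq_le_sq₀ (norm_nonneg _) (norm_nonneg _)).1 (le_of_mul_le_mul_left hsq (half_pos hε))

theorem mem_argmin_penalized_iff (hz : IsTikhonovPath g z) (hg : ConvexOn ℝ univ g) (hε : 0 < ε)
    {u : X} : u ∈ argmin (penalized g ε) ↔ u = z ε :=
  ⟨fun hu => eq_of_mem_argmin_of_strongConvexOn hε (strongConvexOn_penalized hg ε) hu (hz ε hε),
    fun hu => hu ▸ hz ε hε⟩

theorem mul_norm_sub_sq_le_inner (hz : IsTikhonovPath g z) (hg : ConvexOn ℝ univ g) (hε : 0 < ε)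
    (hε' : 0 < ε') : ε * ‖z ε' - z ε‖ ^ 2 ≤ (ε - ε') * inner ℝ (z ε') (z ε' - z ε) := by
  have growth := add_norm_sub_sq_le_of_mem_argmin (strongConvexOn_penalized hg ε) (hz ε hε) (z ε')
  have growth' :=
    add_norm_sub_sq_le_of_mem_argmin (strongConvexOn_penalized hg ε') (hz ε' hε') (z ε)
  have expand := norm_sub_sq_real (z ε') (z ε' - z ε)
  rw [sub_sub_cancel] at expand
  rw [norm_sub_rev (z ε)] at growth'
  simp only [penalized, expand] at growth growth'
  linarith

theorem norm_sub_le (hz : IsTikhonovPath g z) (hg : ConvexOn ℝ univ g) (hε : 0 < ε)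
    (hε' : 0 < ε') : ‖z ε' - z ε‖ ≤ |ε - ε'| / ε * ‖z ε'‖ := by
  rcases (norm_nonneg (z ε' - z ε)).eq_or_lt with h0 | hpos
  · rw [← h0]; positivity
  rw [div_mul_eq_mul_div, le_div_iff₀ hε]
  refine le_of_mul_le_mul_right ?_ hpos
  calc ‖z ε' - z ε‖ * ε * ‖z ε' - z ε‖ = ε * ‖z ε' - z ε‖ ^ 2 := by ring
    _ ≤ (ε - ε') * inner ℝ (z ε') (z ε' - z ε) := hz.mul_norm_sub_sq_le_inner hg hε hε'
    _ ≤ |ε - ε'| * |inner ℝ (z ε') (z ε' - z ε)| := by rw [← abs_mul]; exact le_abs_self _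
    _ ≤ |ε - ε'| * ‖z ε'‖ * ‖z ε' - z ε‖ := by
      rw [mul_assoc]; gcongr; exact abs_real_inner_le_norm _ _

theorem norm_sub_sq_le (hz : IsTikhonovPath g z) (hg : ConvexOn ℝ univ g) (hε' : 0 < ε')
    (hle : ε' ≤ ε) : ‖z ε' - z ε‖ ^ 2 ≤ ‖z ε'‖ ^ 2 - ‖z ε‖ ^ 2 := by
  rcases hle.eq_or_lt with rfl | hlt
  · simp
  have hinner := hz.mul_norm_sub_sq_le_inner hg (hε'.trans hlt) hε'
  have hsq : ‖z ε' - z ε‖ ^ 2 ≤ inner ℝ (z ε') (z ε' - z ε) := by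
    refine le_of_mul_le_mul_left ?_ (sub_pos.2 hlt)
    linarith [mul_nonneg hε'.le (sq_nonneg ‖z ε' - z ε‖)]
  have expand := norm_sub_sq_real (z ε') (z ε' - z ε)
  rw [sub_sub_cancel] at expand
  linarith

theorem continuousOn (hz : IsTikhonovPath g z) (hg : ConvexOn ℝ univ g)
    (hne : (argmin g).Nonempty) : ContinuousOn z (Ioi 0) := by
  obtain ⟨y, hy⟩ := hne
  intro ε hε
  have hε : 0 < ε := hε
  have hbound : Tendsto (fun ε' => |ε - ε'| / ε * ‖y‖) (𝓝[Ioi 0] ε) (𝓝 (|ε - ε| / ε * ‖y‖)) :=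
    ContinuousWithinAt.tendsto (by fun_prop)
  rw [sub_self, abs_zero, zero_div, zero_mul] at hbound
  refine tendsto_iff_norm_sub_tendsto_zero.2
    (squeeze_zero' (Eventually.of_forall fun _ => norm_nonneg _) ?_ hbound)
  filter_upwards [self_mem_nhdsWithin] with ε' hε'
  exact (hz.norm_sub_le hg hε hε').trans (by gcongr; exact hz.norm_le hε' hy)

theorem cauchy_map (hz : IsTikhonovPath g z) (hg : ConvexOn ℝ univ g)
    (hne : (argmin g).Nonempty) : Cauchy (map z (𝓝[>] 0)) := by
  obtain ⟨y, hy⟩ := hne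
  have hanti : AntitoneOn (fun ε => ‖z ε‖ ^ 2) (Ioi 0) := fun ε' hε' ε _ hle =>
    sub_nonneg.1 ((sq_nonneg _).trans (hz.norm_sub_sq_le hg hε' hle))
  have hbdd : BddAbove ((fun ε => ‖z ε‖ ^ 2) '' Ioi 0) :=
    ⟨‖y‖ ^ 2, forall_mem_image.2 fun ε hε => by gcongr; exact hz.norm_le hε hy⟩
  have hnorm : Cauchy (map (fun ε => ‖z ε‖ ^ 2) (𝓝[>] 0)) :=
    (hanti.tendsto_nhdsGT hbdd).cauchy_map
  refine Metric.cauchy_iff.2 ⟨inferInstance, fun e he => ?_⟩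
  obtain ⟨s, hs, hclose⟩ := (Metric.cauchy_iff.1 hnorm).2 (e ^ 2) (by positivity)
  refine ⟨_, image_mem_map (inter_mem hs self_mem_nhdsWithin), ?_⟩
  rintro _ ⟨ε', ⟨hs', hε'⟩, rfl⟩ _ ⟨ε, ⟨hs, hε⟩, rfl⟩
  refine lt_of_pow_lt_pow_left₀ 2 he.le (lt_of_le_of_lt ?_ (hclose _ hs' _ hs))
  rw [dist_eq_norm, Real.dist_eq]
  rcases le_total ε' ε with hle | hle
  · exact (hz.norm_sub_sq_le hg hε' hle).trans (le_abs_self _)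
  · rw [norm_sub_rev, abs_sub_comm]
    exact (hz.norm_sub_sq_le hg hε hle).trans (le_abs_self _)

theorem tendsto [CompleteSpace X] (hz : IsTikhonovPath g z) (hg : ConvexOn ℝ univ g)
    (hcont : Continuous g) {xbar : X} (hxbar : IsMinNormMinimizer g xbar) :
    Tendsto z (𝓝[>] 0) (𝓝 xbar) := by
  obtain ⟨y, hy⟩ := CompleteSpace.complete (hz.cauchy_map hg ⟨xbar, hxbar.1⟩)
  have hlim : Tendsto z (𝓝[>] 0) (𝓝 y) := hy
  have hnorm : ‖y‖ ≤ ‖xbar‖ := le_of_tendsto hlim.norm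
    (mem_of_superset self_mem_nhdsWithin fun ε hε => hz.norm_le hε hxbar.1)
  have hpenalty : Tendsto (fun ε => penalized g ε xbar) (𝓝[>] 0) (𝓝 (penalized g 0 xbar)) :=
    (Continuous.tendsto (by unfold penalized; fun_prop) 0).mono_left nhdsWithin_le_nhds
  have hvalue : g y ≤ penalized g 0 xbar := by
    refine le_of_tendsto_of_tendsto ((hcont.tendsto y).comp hlim) hpenalty ?_
    filter_upwards [self_mem_nhdsWithin] with ε hε
    exact (le_add_of_nonneg_right (mul_nonneg (half_pos hε).le (sq_nonneg _))).trans (hz ε hε xbar)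
  have hmin : IsMinNormMinimizer g y :=
    ⟨fun w => hvalue.trans (by simpa [penalized] using hxbar.1 w),
      fun w hw => hnorm.trans (hxbar.2 w hw)⟩
  rwa [hxbar.eq hg hmin]

end IsTikhonovPath

end TikhonovPath

section Comparison

/-- The lower right Dini derivative of `f` at `t` is at most `v`. -/
def LowerDiniLE (f : ℝ → ℝ) (t v : ℝ) : Prop :=
  ∀ r, v < r → ∃ᶠ s in 𝓝[>] t, slope f t s < r

theorem LowerDiniLE.mono {f : ℝ → ℝ} {t v w : ℝ} (hf : LowerDiniLE f t v) (hvw : v ≤ w) :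
    LowerDiniLE f t w :=
  fun r hr => hf r (hvw.trans_lt hr)

theorem LowerDiniLE.of_hasDerivWithinAt_majorant {f F : ℝ → ℝ} {t v : ℝ}
    (hF : HasDerivWithinAt F v (Ici t) t) (hle : ∀ s, t ≤ s → f s ≤ F s) (heq : f t = F t) :
    LowerDiniLE f t v := by
  intro r hr
  refine ((hF.liminf_right_slope_le hr).and_eventually self_mem_nhdsWithin).mono ?_
  rintro s ⟨hs, hts : t < s⟩
  refine lt_of_le_of_lt ?_ hs
  rw [slope_def_field, slope_def_field, heq]
  exact div_le_div_of_nonneg_right (sub_le_sub_right (hle s hts.le) _) (sub_pos.2 hts).le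

/-- Since `m < 1`, every large multiple of `s ^ (-k)` is eventually a strict supersolution of the
differential inequality `f' ≤ -c s^(-m) f + C s^(-(k + m))`. -/
theorem eventually_lt_deriv_rpow {c C m : ℝ} (hc : 0 < c) (hm : m < 1) (k : ℝ) :
    ∀ᶠ s : ℝ in atTop, ∀ A, 0 < A → 2 * C < c * A →
      -(c * s ^ (-m)) * (A * s ^ (-k)) + C * s ^ (-(k + m)) < A * (-k * s ^ (-k - 1)) := by
  have hsmall : Tendsto (fun s : ℝ => k * s ^ (-(1 - m))) atTop (𝓝 (k * 0)) :=
    (tendsto_rpow_neg_atTop (by linarith)).const_mul k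
  rw [mul_zero] at hsmall
  filter_upwards [hsmall.eventually_le_const (half_pos hc), eventually_gt_atTop 0]
    with s hs hs0 A hA hAC
  have : 0 < s ^ (-(k + m)) := Real.rpow_pos_of_pos hs0 _
  have hsplit : s ^ (-m) * s ^ (-k) = s ^ (-(k + m)) := by
    rw [← Real.rpow_add hs0]; congr 1; ring
  have hsplit' : s ^ (-k - 1) = s ^ (-(1 - m)) * s ^ (-(k + m)) := by
    rw [← Real.rpow_add hs0]; congr 1; ring
  calc -(c * s ^ (-m)) * (A * s ^ (-k)) + C * s ^ (-(k + m))
      = (C - c * A) * s ^ (-(k + m)) := by rw [← hsplit]; ring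
    _ < (-(A * (k * s ^ (-(1 - m))))) * s ^ (-(k + m)) := by
      gcongr
      linarith [mul_le_mul_of_nonneg_left hs hA.le]
    _ = A * (-k * s ^ (-k - 1)) := by rw [hsplit']; ring

theorem exists_le_mul_rpow_of_lowerDiniLE {f : ℝ → ℝ} {c C m k T : ℝ} (hc : 0 < c)
    (hm : m < 1) (hf : ContinuousOn f (Ici T))
    (hdini : ∀ᶠ t in atTop, LowerDiniLE f t (-(c * t ^ (-m)) * f t + C * t ^ (-(k + m)))) :
    ∃ B, ∀ᶠ t in atTop, f t ≤ B * t ^ (-k) := by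
  obtain ⟨S, hS⟩ := eventually_atTop.1 (((hdini.and (eventually_lt_deriv_rpow (C := C) hc hm k)).and
    (eventually_gt_atTop 0)).and (eventually_ge_atTop T))
  have hS0 : 0 < S := (hS S le_rfl).1.2
  obtain ⟨A, hA⟩ := exists_gt (max (max 0 (2 * C / c)) (f S * S ^ k))
  obtain ⟨hA', hAS⟩ := max_lt_iff.1 hA
  obtain ⟨hA0, hAC⟩ := max_lt_iff.1 hA'
  have hderiv : ∀ s, S ≤ s →
      HasDerivAt (fun s : ℝ => A * s ^ (-k)) (A * (-k * s ^ (-k - 1))) s := fun s hs =>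
    (Real.hasDerivAt_rpow_const (Or.inl (hS0.trans_le hs).ne')).const_mul A
  refine ⟨A, eventually_atTop.2 ⟨S, fun t ht => ?_⟩⟩
  refine image_le_of_liminf_slope_right_lt_deriv_boundary' (a := S) (b := t)
    (hf.mono fun s hs => (hS s hs.1).2) (fun s hs => (hS s hs.1).1.1.1) ?_
    (fun s hs => (hderiv s hs.1).continuousAt.continuousWithinAt)
    (fun s hs => (hderiv s hs.1).hasDerivWithinAt) (fun s hs heq => ?_) ⟨ht, le_rfl⟩
  · rw [Real.rpow_neg hS0.le, ← div_eq_mul_inv, le_div_iff₀ (Real.rpow_pos_of_pos hS0 k)]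
    exact hAS.le
  · rw [heq]
    exact (hS s hs.1).1.1.2 A hA0 (by rwa [div_lt_iff₀' hc] at hAC)

theorem hasDerivWithinAt_mul_of_eq_zero {𝕜 : Type*} [NontriviallyNormedField 𝕜] {h D : 𝕜 → 𝕜}
    {D' t : 𝕜} {s : Set 𝕜} (hh : ContinuousWithinAt h s t) (hD : HasDerivWithinAt D D' s t)
    (hD0 : D t = 0) : HasDerivWithinAt (fun r => h r * D r) (h t * D') s t := by
  rw [hasDerivWithinAt_iff_tendsto_slope] at hD ⊢
  refine ((hh.mono_left (nhdsWithin_mono _ sdiff_subset)).mul hD).congr fun r => ?_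
  simp only [slope_def_field, hD0]
  ring

end Comparison

section Energy

variable {X : Type*} [NormedAddCommGroup X] [InnerProductSpace ℝ X] {g : X → ℝ}
  {β δ ε γ : ℝ} {x v z : X}

/-- The Lyapunov energy of the state with position `x` and shifted velocity `v = x' + β ∇g(x)`,
for the viscosity `γ` and the minimizer `z` of the Tikhonov regularization of parameter `ε`. -/
noncomputable def energy (g : X → ℝ) (δ ε γ : ℝ) (x v z : X) : ℝ :=
  δ * (penalized g ε x - penalized g ε z) + 1 / 4 * ‖v‖ ^ 2 + 1 / 4 * ‖v + γ • (x - z)‖ ^ 2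

theorem norm_sq_le_energy (hδ : 0 ≤ δ) (hz : z ∈ argmin (penalized g ε)) :
    ‖v‖ ^ 2 ≤ 4 * energy g δ ε γ x v z := by
  have hgap := mul_nonneg hδ (sub_nonneg.2 (hz x))
  unfold energy
  linarith [sq_nonneg ‖v + γ • (x - z)‖]

theorem norm_add_sq_le {E : Type*} [SeminormedAddGroup E] (u w : E) :
    ‖u + w‖ ^ 2 ≤ 2 * (‖u‖ ^ 2 + ‖w‖ ^ 2) :=
  (pow_le_pow_left₀ (norm_nonneg _) (norm_add_le u w) 2).trans add_sq_le

theorem sq_mul_norm_sub_sq_le_energy (hδ : 0 ≤ δ) (hz : z ∈ argmin (penalized g ε)) :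
    γ ^ 2 * ‖x - z‖ ^ 2 ≤ 8 * energy g δ ε γ x v z := by
  have hgap := mul_nonneg hδ (sub_nonneg.2 (hz x))
  have hsplit := norm_add_sq_le (v + γ • (x - z)) (-v)
  rw [add_neg_cancel_comm, norm_neg, norm_smul, mul_pow, Real.norm_eq_abs, sq_abs] at hsplit
  unfold energy
  linarith

theorem mul_norm_sub_sq_le_energy (hg : ConvexOn ℝ univ g) (hδ : 0 ≤ δ)
    (hz : z ∈ argmin (penalized g ε)) :
    δ * ε / 2 * ‖x - z‖ ^ 2 ≤ energy g δ ε γ x v z := by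
  have hgrowth := add_norm_sub_sq_le_of_mem_argmin (strongConvexOn_penalized hg ε) hz x
  have hgap := mul_le_mul_of_nonneg_left (le_sub_iff_add_le'.2 hgrowth) hδ
  unfold energy
  linarith [sq_nonneg ‖v‖, sq_nonneg ‖v + γ • (x - z)‖]

theorem mul_sub_le_energy_add (hδ : 0 ≤ δ) (hε : 0 ≤ ε) (hz : z ∈ argmin (penalized g ε)) (y : X) :
    δ * (g x - g y) ≤ energy g δ ε γ x v z + δ * ε / 2 * ‖y‖ ^ 2 := by
  have hgap : g x - g y ≤ penalized g ε x - penalized g ε z + ε / 2 * ‖y‖ ^ 2 := by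
    have hmin := hz y
    simp only [penalized] at hmin ⊢
    linarith [mul_nonneg (div_nonneg hε zero_le_two) (sq_nonneg ‖x‖)]
  have hmul := mul_le_mul_of_nonneg_left hgap hδ
  unfold energy
  linarith [sq_nonneg ‖v‖, sq_nonneg ‖v + γ • (x - z)‖]

theorem energy_le : energy g δ ε γ x v z ≤ δ * (penalized g ε x - penalized g ε z)
    + 3 / 4 * ‖v‖ ^ 2 + γ ^ 2 / 2 * ‖x - z‖ ^ 2 := by
  have hsplit := norm_add_sq_le v (γ • (x - z))
  rw [norm_smul, mul_pow, Real.norm_eq_abs, sq_abs] at hsplit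
  unfold energy
  linarith

theorem penalized_sub_add_le_inner [CompleteSpace X] (hg : ConvexOn ℝ univ g)
    (hd : Differentiable ℝ g) (ε : ℝ) (x z : X) :
    penalized g ε x - penalized g ε z + ε / 2 * ‖x - z‖ ^ 2
      ≤ inner ℝ (x - z) (gradient g x + ε • x) := by
  have htangent := add_inner_gradient_le hg hd x z
  rw [← neg_sub x z, inner_neg_right, real_inner_comm] at htangent
  have hcross : inner ℝ (x - z) x = ‖x‖ ^ 2 - inner ℝ x z := by
    rw [inner_sub_left, real_inner_self_eq_norm_sq, real_inner_comm]
  rw [inner_add_right, real_inner_smul_right, hcross, norm_sub_sq_real]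
  simp only [penalized]
  linarith

theorem mul_inner_sub_mul_inner_le (hβ : 0 ≤ β) (hγ : 0 ≤ γ) (hγδ : γ * β ≤ δ) (ε : ℝ)
    (n x v : X) :
    γ * β / 2 * inner ℝ v n - β * δ * inner ℝ (n + ε • x) n
      ≤ γ / 8 * ‖v‖ ^ 2 + β * δ * ε ^ 2 / 2 * ‖x‖ ^ 2 := by
  have hv := mul_nonneg hγ (sq_nonneg ‖v - (2 * β) • n‖)
  have hx := mul_nonneg (mul_nonneg hβ ((mul_nonneg hγ hβ).trans hγδ)) (sq_nonneg ‖n + ε • x‖)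
  have hn := mul_nonneg (mul_nonneg hβ (sub_nonneg.2 hγδ)) (sq_nonneg ‖n‖)
  rw [norm_sub_sq_real, norm_smul, real_inner_smul_right, mul_pow, Real.norm_eq_abs, sq_abs] at hv
  rw [norm_add_sq_real, norm_smul, real_inner_smul_right, mul_pow, Real.norm_eq_abs, sq_abs,
    real_inner_comm] at hx
  rw [inner_add_left, real_inner_smul_left, real_inner_self_eq_norm_sq]
  linarith

end Energy

section Dissipation

variable {X : Type*} [NormedAddCommGroup X] [InnerProductSpace ℝ X]
  {g : X → ℝ} {β δ δ' ε γ γ' ρ r M : ℝ} {v x z : X}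

/-- The right derivative of a majorant of the energy along a trajectory with velocity `x'`. The
majorant keeps `z` fixed and bounds the displacement of the minimizers, of norm at most `M`, in
terms of the logarithmic rate of decay `ρ` of the Tikhonov parameter `ε`. -/
noncomputable def energyRate [CompleteSpace X] (g : X → ℝ) (δ δ' ε ρ γ γ' M : ℝ)
    (x x' v v' z : X) : ℝ :=
  δ' * (penalized g ε x - penalized g ε z)
    + δ * (inner ℝ (gradient g x + ε • x) x' + ε * ρ / 2 * (M ^ 2 - ‖x‖ ^ 2))
    + 1 / 2 * inner ℝ v v'
    + 1 / 2 * inner ℝ (v + γ • (x - z)) (v' + (γ' • (x - z) + γ • x'))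
    + 1 / 2 * ‖v + γ • (x - z)‖ * (γ * (ρ * M))

/-- Size relations between the coefficients, their derivatives and the Tikhonov parameter at a
single time, under which the energy dissipates. -/
structure DissipativeRegime (β δ δ' ε γ γ' : ℝ) : Prop where
  β_nonneg : 0 ≤ β
  δ_pos : 0 < δ
  ε_pos : 0 < ε
  γ_pos : 0 < γ
  γ_mul_β_le : γ * β ≤ δ
  β_mul_ε_le : β * ε ≤ γ / 32
  δ'_le : δ' ≤ γ / 4 * δ
  sq_γ'_le : γ' ^ 2 ≤ γ ^ 2 * (δ * ε / 32)
  abs_γ'_le : |γ'| ≤ δ * ε / 16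

theorem inner_dynamics_eq (e n v w : X) :
    δ * inner ℝ e (v - β • n) + 1 / 2 * inner ℝ v (-(γ • (v - β • n)) - δ • e)
        + 1 / 2 * inner ℝ (v + γ • w)
          (-(γ • (v - β • n)) - δ • e + (γ' • w + γ • (v - β • n)))
      = -(γ / 2) * ‖v‖ ^ 2 + (γ * β / 2 * inner ℝ v n - β * δ * inner ℝ e n)
        - γ * δ / 2 * inner ℝ w e + γ' / 2 * inner ℝ (v + γ • w) w := by
  have hcancel : -(γ • (v - β • n)) - δ • e + (γ' • w + γ • (v - β • n)) = γ' • w - δ • e := by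
    abel
  rw [hcancel]
  simp only [inner_add_left, inner_sub_right, inner_neg_right, real_inner_smul_left,
    real_inner_smul_right, real_inner_self_eq_norm_sq, real_inner_comm e v]
  ring

theorem DissipativeRegime.mul_norm_sq_le {E : Type*} [SeminormedAddGroup E] {x z : E}
    (h : DissipativeRegime β δ δ' ε γ γ') (hzM : ‖z‖ ≤ M) :
    β * δ * ε ^ 2 / 2 * ‖x‖ ^ 2
      ≤ γ * (δ * ε) / 32 * ‖x - z‖ ^ 2 + β * ε * (δ * ε) * M ^ 2 := by
  have hμ : 0 < δ * ε := mul_pos h.δ_pos h.ε_pos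
  have hx : ‖x‖ ^ 2 ≤ 2 * (‖x - z‖ ^ 2 + M ^ 2) := by
    have hsplit := norm_add_sq_le (x - z) z
    rw [sub_add_cancel] at hsplit
    exact hsplit.trans (by gcongr)
  calc β * δ * ε ^ 2 / 2 * ‖x‖ ^ 2 ≤ β * δ * ε ^ 2 / 2 * (2 * (‖x - z‖ ^ 2 + M ^ 2)) := by
        have := mul_nonneg h.β_nonneg h.δ_pos.le
        gcongr
    _ = β * ε * (δ * ε) * ‖x - z‖ ^ 2 + β * ε * (δ * ε) * M ^ 2 := by ring
    _ ≤ γ / 32 * (δ * ε) * ‖x - z‖ ^ 2 + β * ε * (δ * ε) * M ^ 2 := by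
        gcongr; exact h.β_mul_ε_le
    _ = γ * (δ * ε) / 32 * ‖x - z‖ ^ 2 + β * ε * (δ * ε) * M ^ 2 := by ring

theorem DissipativeRegime.inner_add_smul_le (h : DissipativeRegime β δ δ' ε γ γ') (v w : X) :
    γ' / 2 * inner ℝ (v + γ • w) w
      ≤ γ / 16 * ‖v‖ ^ 2 + γ * (δ * ε) / 16 * ‖w‖ ^ 2 := by
  have hγ := h.γ_pos
  have hcross : γ' / 2 * inner ℝ v w ≤ γ / 16 * ‖v‖ ^ 2 + γ * (δ * ε) / 32 * ‖w‖ ^ 2 := by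
    have hsq := mul_nonneg hγ.le (sq_nonneg ‖v - (4 * γ' / γ) • w‖)
    rw [norm_sub_sq_real, norm_smul, real_inner_smul_right, mul_pow, Real.norm_eq_abs, sq_abs]
      at hsq
    have hexpand : γ * (‖v‖ ^ 2 - 2 * (4 * γ' / γ * inner ℝ v w) + (4 * γ' / γ) ^ 2 * ‖w‖ ^ 2)
        = γ * ‖v‖ ^ 2 - 8 * γ' * inner ℝ v w + 16 * (γ' ^ 2 / γ) * ‖w‖ ^ 2 := by
      field_simp
      ring
    have hratio : γ' ^ 2 / γ ≤ γ * (δ * ε / 32) := by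
      rw [div_le_iff₀ hγ]; linarith [h.sq_γ'_le]
    linarith [mul_le_mul_of_nonneg_right hratio (sq_nonneg ‖w‖)]
  have hself : γ' / 2 * (γ * ‖w‖ ^ 2) ≤ γ * (δ * ε) / 32 * ‖w‖ ^ 2 := by
    have := mul_le_mul_of_nonneg_right ((le_abs_self γ').trans h.abs_γ'_le)
      (mul_nonneg hγ.le (sq_nonneg ‖w‖))
    linarith
  rw [inner_add_left, real_inner_smul_left, real_inner_self_eq_norm_sq]
  linarith

theorem norm_add_smul_mul_le {μ b : ℝ} (hγ : 0 < γ) (hμ : 0 < μ) (hb : 0 ≤ b) (v w : X) :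
    1 / 2 * ‖v + γ • w‖ * (γ * b)
      ≤ γ / 8 * ‖v‖ ^ 2 + γ * μ / 16 * ‖w‖ ^ 2 + γ * b ^ 2 * (1 / 2 + γ ^ 2 / μ) := by
  have hv : ‖v‖ * b ≤ 1 / 4 * ‖v‖ ^ 2 + b ^ 2 := by
    linarith [sq_nonneg (1 / 2 * ‖v‖ - b)]
  have hw : γ * ‖w‖ * b ≤ μ / 8 * ‖w‖ ^ 2 + 2 * (γ ^ 2 / μ) * b ^ 2 := by
    have hsq := mul_nonneg hμ.le (sq_nonneg (‖w‖ - 4 * γ / μ * b))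
    have hexpand : μ * (‖w‖ - 4 * γ / μ * b) ^ 2
        = μ * ‖w‖ ^ 2 - 8 * (γ * ‖w‖ * b) + 16 * (γ ^ 2 / μ) * b ^ 2 := by
      field_simp
      ring
    linarith
  have hnorm : ‖v + γ • w‖ ≤ ‖v‖ + γ * ‖w‖ := by
    simpa [norm_smul, abs_of_pos hγ] using norm_add_le v (γ • w)
  calc 1 / 2 * ‖v + γ • w‖ * (γ * b) ≤ 1 / 2 * (‖v‖ + γ * ‖w‖) * (γ * b) := by gcongr
    _ = γ / 2 * (‖v‖ * b + γ * ‖w‖ * b) := by ring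
    _ ≤ γ / 2 * (1 / 4 * ‖v‖ ^ 2 + b ^ 2 + (μ / 8 * ‖w‖ ^ 2 + 2 * (γ ^ 2 / μ) * b ^ 2)) := by
      gcongr
    _ = γ / 8 * ‖v‖ ^ 2 + γ * μ / 16 * ‖w‖ ^ 2 + γ * b ^ 2 * (1 / 2 + γ ^ 2 / μ) := by ring

variable [CompleteSpace X]

theorem DissipativeRegime.energyRate_le_neg_add (h : DissipativeRegime β δ δ' ε γ γ')
    (hg : ConvexOn ℝ univ g) (hd : Differentiable ℝ g) (hz : z ∈ argmin (penalized g ε))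
    (hzM : ‖z‖ ≤ M) (hρ : 0 ≤ ρ) {x' v' : X} (hx' : x' = v - β • gradient g x)
    (hv' : v' = -(γ • x') - δ • (gradient g x + ε • x)) :
    energyRate g δ δ' ε ρ γ γ' M x x' v v' z
      ≤ -(γ / 4 * (δ * (penalized g ε x - penalized g ε z)) + 3 / 16 * γ * ‖v‖ ^ 2
          + 1 / 16 * (γ * (δ * ε) * ‖x - z‖ ^ 2))
        + (δ * ε * (β * ε + ρ / 2) + γ * ρ ^ 2 * (1 / 2 + γ ^ 2 / (δ * ε))) * M ^ 2 := by
  have hμ : 0 < δ * ε := mul_pos h.δ_pos h.ε_pos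
  have hdynamics := inner_dynamics_eq (δ := δ) (β := β) (γ := γ) (γ' := γ')
    (gradient g x + ε • x) (gradient g x) v (x - z)
  have hcurvature := mul_inner_sub_mul_inner_le h.β_nonneg h.γ_pos.le h.γ_mul_β_le ε
    (gradient g x) x v
  have hpenalty := h.mul_norm_sq_le (x := x) hzM
  have hmonotone := mul_le_mul_of_nonneg_left (penalized_sub_add_le_inner hg hd ε x z)
    (mul_nonneg h.γ_pos.le h.δ_pos.le)
  have hviscosity := h.inner_add_smul_le v (x - z)
  have hdrift := norm_add_smul_mul_le h.γ_pos hμ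
    (mul_nonneg hρ ((norm_nonneg z).trans hzM)) v (x - z)
  have hscaling := mul_le_mul_of_nonneg_right h.δ'_le (sub_nonneg.2 (hz x))
  have hdecay : 0 ≤ δ * ε * ρ * ‖x‖ ^ 2 := by positivity
  have hdist : 0 ≤ γ * (δ * ε) * ‖x - z‖ ^ 2 :=
    mul_nonneg (mul_pos h.γ_pos hμ).le (sq_nonneg _)
  subst hv' hx'
  unfold energyRate
  linarith

theorem DissipativeRegime.energyRate_le (h : DissipativeRegime β δ δ' ε γ γ')
    (hg : ConvexOn ℝ univ g) (hd : Differentiable ℝ g) (hz : z ∈ argmin (penalized g ε))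
    (hzM : ‖z‖ ≤ M) (hρ : 0 ≤ ρ) (hr : 0 ≤ r) (hrγ : r ≤ γ / 4) (hrμ : r * γ ≤ δ * ε / 8)
    {x' v' : X} (hx' : x' = v - β • gradient g x)
    (hv' : v' = -(γ • x') - δ • (gradient g x + ε • x)) :
    energyRate g δ δ' ε ρ γ γ' M x x' v v' z ≤ -r * energy g δ ε γ x v z
      + (δ * ε * (β * ε + ρ / 2) + γ * ρ ^ 2 * (1 / 2 + γ ^ 2 / (δ * ε))) * M ^ 2 := by
  refine (h.energyRate_le_neg_add hg hd hz hzM hρ hx' hv').trans ?_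
  have hgap := mul_le_mul_of_nonneg_right hrγ (mul_nonneg h.δ_pos.le (sub_nonneg.2 (hz x)))
  have hvelocity := mul_le_mul_of_nonneg_right hrγ (sq_nonneg ‖v‖)
  have hdist := mul_le_mul_of_nonneg_right hrμ (mul_nonneg h.γ_pos.le (sq_nonneg ‖x - z‖))
  have henergy := mul_le_mul_of_nonneg_left (energy_le (g := g) (δ := δ) (ε := ε) (γ := γ)
    (x := x) (v := v) (z := z)) hr
  linarith

end Dissipation

section Majorant

variable {X : Type*} [NormedAddCommGroup X] [InnerProductSpace ℝ X] {g : X → ℝ} {z : ℝ → X}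
  {M : ℝ}

theorem IsTikhonovPath.penalized_sub_le {E : Type*} [NormedAddCommGroup E] {g : E → ℝ} {z : ℝ → E}
    {M ε ε' : ℝ} (hz : IsTikhonovPath g z) (hε : 0 < ε) (hle : ε' ≤ ε) (hM : ‖z ε'‖ ≤ M) :
    penalized g ε (z ε) - (ε - ε') / 2 * M ^ 2 ≤ penalized g ε' (z ε') := by
  have hmin := hz ε hε (z ε')
  have hsq : (ε - ε') / 2 * ‖z ε'‖ ^ 2 ≤ (ε - ε') / 2 * M ^ 2 := by
    have := sub_nonneg.2 hle
    gcongr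
  simp only [penalized] at hmin ⊢
  linarith

theorem norm_add_smul_sub_sq_le {γ D : ℝ} {z₀ z₁ : X} (hγ : 0 ≤ γ) (hD : ‖z₁ - z₀‖ ≤ D)
    (x v : X) : ‖v + γ • (x - z₁)‖ ^ 2 ≤
      ‖v + γ • (x - z₀)‖ ^ 2 + (2 * ‖v + γ • (x - z₀)‖ + γ * D) * γ * D := by
  have hshift : v + γ • (x - z₁) = (v + γ • (x - z₀)) - γ • (z₁ - z₀) := by
    simp only [smul_sub]; abel
  have hnorm : ‖v + γ • (x - z₁)‖ ≤ ‖v + γ • (x - z₀)‖ + γ * D := by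
    rw [hshift]
    refine (norm_sub_le _ _).trans ?_
    rw [norm_smul, Real.norm_of_nonneg hγ]
    gcongr
  calc ‖v + γ • (x - z₁)‖ ^ 2 ≤ (‖v + γ • (x - z₀)‖ + γ * D) ^ 2 := by gcongr
    _ = ‖v + γ • (x - z₀)‖ ^ 2 + (2 * ‖v + γ • (x - z₀)‖ + γ * D) * γ * D := by ring

/-- A majorant of the energy of a later state, in terms of the minimizer `z₀` for the current
Tikhonov parameter `ε₀`. Unlike the energy, it is differentiable along a trajectory at the time
where `ε = ε₀`. -/
noncomputable def energyMajorant (g : X → ℝ) (M ε₀ : ℝ) (z₀ : X) (δ ε γ : ℝ) (x v : X) : ℝ :=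
  δ * (penalized g ε x - penalized g ε₀ z₀ + (ε₀ - ε) / 2 * M ^ 2) + 1 / 4 * ‖v‖ ^ 2
    + 1 / 4 * (‖v + γ • (x - z₀)‖ ^ 2
      + (2 * ‖v + γ • (x - z₀)‖ + γ * ((ε₀ - ε) / ε₀ * M)) * γ * ((ε₀ - ε) / ε₀ * M))

theorem energyMajorant_self (g : X → ℝ) (M ε : ℝ) (z : X) (δ γ : ℝ) (x v : X) :
    energyMajorant g M ε z δ ε γ x v = energy g δ ε γ x v z := by
  simp [energyMajorant, energy]

theorem IsTikhonovPath.energy_le_energyMajorant {δ ε₀ ε γ : ℝ} (hz : IsTikhonovPath g z)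
    (hg : ConvexOn ℝ univ g) (hδ : 0 ≤ δ) (hγ : 0 ≤ γ) (hε : 0 < ε) (hle : ε ≤ ε₀)
    (hM : ‖z ε‖ ≤ M) (x v : X) :
    energy g δ ε γ x v (z ε) ≤ energyMajorant g M ε₀ (z ε₀) δ ε γ x v := by
  have hε₀ : 0 < ε₀ := hε.trans_le hle
  have hdist : ‖z ε - z ε₀‖ ≤ (ε₀ - ε) / ε₀ * M := by
    have hdrift := hz.norm_sub_le hg hε₀ hε
    rw [abs_of_nonneg (sub_nonneg.2 hle)] at hdrift
    exact hdrift.trans (mul_le_mul_of_nonneg_left hM (div_nonneg (sub_nonneg.2 hle) hε₀.le))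
  have hgap : penalized g ε x - penalized g ε (z ε)
      ≤ penalized g ε x - penalized g ε₀ (z ε₀) + (ε₀ - ε) / 2 * M ^ 2 := by
    linarith [hz.penalized_sub_le hε₀ hle hM]
  have hkinetic := norm_add_smul_sub_sq_le hγ hdist x v
  unfold energy energyMajorant
  gcongr

variable [CompleteSpace X] {δ ε γ : ℝ → ℝ} {x v : ℝ → X} {δ' ε' γ' ρ t : ℝ} {x' v' : X} {S : Set ℝ}

theorem hasDerivWithinAt_penalized (hd : Differentiable ℝ g) (hε : HasDerivWithinAt ε ε' S t)
    (hx : HasDerivWithinAt x x' S t) :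
    HasDerivWithinAt (fun s => penalized g (ε s) (x s))
      (inner ℝ (gradient g (x t) + ε t • x t) x' + ε' / 2 * ‖x t‖ ^ 2) S t := by
  have hvalue : HasDerivWithinAt (fun s => g (x s)) (inner ℝ (gradient g (x t)) x') S t := by
    rw [inner_gradient_left]
    exact (hd (x t)).hasFDerivAt.comp_hasDerivWithinAt t hx
  refine (hvalue.add ((hε.div_const 2).mul hx.norm_sq)).congr_deriv ?_
  rw [inner_add_left, real_inner_smul_left]
  ring

theorem hasDerivWithinAt_energyMajorant (hd : Differentiable ℝ g) (hε₀ : ε t ≠ 0) (M : ℝ)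
    (z₀ : X) (hδ : HasDerivWithinAt δ δ' S t) (hε : HasDerivWithinAt ε (-(ε t * ρ)) S t)
    (hγ : HasDerivWithinAt γ γ' S t) (hx : HasDerivWithinAt x x' S t)
    (hv : HasDerivWithinAt v v' S t) :
    HasDerivWithinAt (fun s => energyMajorant g M (ε t) z₀ (δ s) (ε s) (γ s) (x s) (v s))
      (energyRate g (δ t) δ' (ε t) ρ (γ t) γ' M (x t) x' (v t) v' z₀) S t := by
  set u : ℝ → X := fun s => v s + γ s • (x s - z₀)
  set D : ℝ → ℝ := fun s => (ε t - ε s) / ε t * M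
  have hu : HasDerivWithinAt u (v' + (γ t • x' + γ' • (x t - z₀))) S t :=
    hv.add (hγ.smul (hx.sub_const z₀))
  have hD : HasDerivWithinAt D (ρ * M) S t :=
    (((hε.const_sub (ε t)).div_const (ε t)).mul_const M).congr_deriv (by field_simp)
  have hcont : ContinuousWithinAt (fun s => (2 * ‖u s‖ + γ s * D s) * γ s) S t :=
    ((hu.continuousWithinAt.norm.const_mul 2).add
      (hγ.continuousWithinAt.mul hD.continuousWithinAt)).mul hγ.continuousWithinAt
  have hpotential := hδ.mul (((hasDerivWithinAt_penalized hd hε hx).sub_const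
    (penalized g (ε t) z₀)).add (((hε.const_sub (ε t)).div_const 2).mul_const (M ^ 2)))
  refine ((hpotential.add (hv.norm_sq.const_mul (1 / 4))).add ((hu.norm_sq.add
    (hasDerivWithinAt_mul_of_eq_zero hcont hD (by simp [D]))).const_mul (1 / 4))).congr_deriv ?_
  simp only [energyRate, u, D, Pi.add_apply, sub_self, add_comm (γ t • x')]
  ring

theorem IsTikhonovPath.lowerDiniLE_energy (hz : IsTikhonovPath g z) (hg : ConvexOn ℝ univ g)
    (hd : Differentiable ℝ g) (hM : ∀ ε, 0 < ε → ‖z ε‖ ≤ M) (hδ_nonneg : ∀ s, t ≤ s → 0 ≤ δ s)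
    (hγ_nonneg : ∀ s, t ≤ s → 0 ≤ γ s) (hε_pos : ∀ s, t ≤ s → 0 < ε s)
    (hε_anti : ∀ s, t ≤ s → ε s ≤ ε t) (hδ : HasDerivWithinAt δ δ' (Ici t) t)
    (hε : HasDerivWithinAt ε (-(ε t * ρ)) (Ici t) t) (hγ : HasDerivWithinAt γ γ' (Ici t) t)
    (hx : HasDerivWithinAt x x' (Ici t) t) (hv : HasDerivWithinAt v v' (Ici t) t) :
    LowerDiniLE (fun s => energy g (δ s) (ε s) (γ s) (x s) (v s) (z (ε s))) t
      (energyRate g (δ t) δ' (ε t) ρ (γ t) γ' M (x t) x' (v t) v' (z (ε t))) :=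
  .of_hasDerivWithinAt_majorant
    (hasDerivWithinAt_energyMajorant hd (hε_pos t le_rfl).ne' M (z (ε t)) hδ hε hγ hx hv)
    (fun s hs => hz.energy_le_energyMajorant hg (hδ_nonneg s hs) (hγ_nonneg s hs) (hε_pos s hs)
      (hε_anti s hs) (hM _ (hε_pos s hs)) (x s) (v s))
    (energyMajorant_self g M (ε t) (z (ε t)) (δ t) (γ t) (x t) (v t)).symm

end Majorant

section Coefficients

theorem eventually_mul_rpow_le {u w : ℝ} (h : w < u) (C : ℝ) {c : ℝ} (hc : 0 < c) :
    ∀ᶠ t : ℝ in atTop, C * t ^ (-u) ≤ c * t ^ (-w) := by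
  have hlim : Tendsto (fun t : ℝ => C * t ^ (-(u - w))) atTop (𝓝 (C * 0)) :=
    (tendsto_rpow_neg_atTop (sub_pos.2 h)).const_mul C
  rw [mul_zero] at hlim
  filter_upwards [hlim.eventually_le_const hc, eventually_gt_atTop 0] with t ht ht0
  calc C * t ^ (-u) = C * t ^ (-(u - w)) * t ^ (-w) := by
        rw [mul_assoc, ← Real.rpow_add ht0]; congr 2; ring
    _ ≤ c * t ^ (-w) := by gcongr

/-- The Tikhonov parameter `a / (δ(t) t^p)`, for which `regularized g a p δ t` is
`penalized g (tikhonovParam a p δ t)`. -/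
noncomputable def tikhonovParam (a p : ℝ) (δ : ℝ → ℝ) (t : ℝ) : ℝ :=
  a / (δ t * t ^ p)

/-- The logarithmic rate of decay `-ε'/ε` of the Tikhonov parameter `ε`. -/
noncomputable def tikhonovDecayRate (p t₀ : ℝ) (δ : ℝ → ℝ) (t : ℝ) : ℝ :=
  timeDeriv t₀ δ t / δ t + p / t

/-- The growth conditions on the time scaling `δ` of the gradient: eventually `(t^p δ)' ≥ a β`, and
the logarithmic derivative of `δ` is at most of order `1 / t`. -/
structure AdmissibleScaling (a β p t₀ : ℝ) (δ : ℝ → ℝ) : Prop where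
  pos : ∀ t, t₀ ≤ t → 0 < δ t
  differentiableOn : DifferentiableOn ℝ δ (Ici t₀)
  lower : ∀ᶠ t in atTop, 0 ≤ t ^ p * timeDeriv t₀ δ t + p * t ^ (p - 1) * δ t - a * β
  upper : ∃ K, ∀ᶠ t in atTop, t * timeDeriv t₀ δ t < K * δ t

variable {a β p t₀ t : ℝ} {δ : ℝ → ℝ}

theorem regularized_eq_penalized {X : Type*} [NormedAddCommGroup X] (g : X → ℝ) (a p : ℝ)
    (δ : ℝ → ℝ) (t : ℝ) : regularized g a p δ t = penalized g (tikhonovParam a p δ t) := by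
  funext z
  rw [regularized, penalized, tikhonovParam, div_div]
  ring_nf

theorem tikhonovParam_pos (ha : 0 < a) (ht : 0 < t) (hδ : 0 < δ t) : 0 < tikhonovParam a p δ t :=
  div_pos ha (mul_pos hδ (Real.rpow_pos_of_pos ht p))

theorem mul_tikhonovParam (ht : 0 < t) (hδ : 0 < δ t) :
    δ t * tikhonovParam a p δ t = a * t ^ (-p) := by
  rw [tikhonovParam, Real.rpow_neg ht.le]
  field_simp

theorem hasDerivWithinAt_tikhonovParam (ht : 0 < t) (hδ : δ t ≠ 0)
    (hδ' : DifferentiableWithinAt ℝ δ (Ici t₀) t) :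
    HasDerivWithinAt (tikhonovParam a p δ)
      (-(tikhonovParam a p δ t * tikhonovDecayRate p t₀ δ t)) (Ici t₀) t := by
  have hpow : HasDerivWithinAt (fun s : ℝ => s ^ p) (p * t ^ (p - 1)) (Ici t₀) t :=
    (Real.hasDerivAt_rpow_const (Or.inl ht.ne')).hasDerivWithinAt
  have htp : t ^ p ≠ 0 := (Real.rpow_pos_of_pos ht p).ne'
  refine ((hasDerivWithinAt_const t (Ici t₀) a).div (hδ'.hasDerivWithinAt.mul hpow)
    (mul_ne_zero hδ htp)).congr_deriv ?_
  simp only [Pi.mul_apply, tikhonovParam, tikhonovDecayRate, timeDeriv, Real.rpow_sub_one ht.ne']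
  field_simp
  ring

theorem AdmissibleScaling.exists_monotoneOn_mul_rpow_sub (h : AdmissibleScaling a β p t₀ δ)
    (ht₀ : 0 < t₀) :
    ∃ T, t₀ ≤ T ∧ MonotoneOn (fun t => δ t * t ^ p - a * β * t) (Ici T) := by
  obtain ⟨T, hT⟩ := eventually_atTop.1 (h.lower.and (eventually_ge_atTop t₀))
  have hTt₀ : t₀ ≤ T := (hT T le_rfl).2
  have hderiv : ∀ t ∈ Ici T, HasDerivWithinAt (fun t => δ t * t ^ p - a * β * t)
      (t ^ p * timeDeriv t₀ δ t + p * t ^ (p - 1) * δ t - a * β) (Ici T) t := fun t ht => by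
    have hpow : HasDerivWithinAt (fun t : ℝ => t ^ p) (p * t ^ (p - 1)) (Ici T) t :=
      (Real.hasDerivAt_rpow_const (Or.inl (ht₀.trans_le (hTt₀.trans ht)).ne')).hasDerivWithinAt
    have hδ : HasDerivWithinAt δ (timeDeriv t₀ δ t) (Ici T) t :=
      (h.differentiableOn t (hTt₀.trans ht)).hasDerivWithinAt.mono (Ici_subset_Ici.2 hTt₀)
    exact ((hδ.mul hpow).sub ((hasDerivWithinAt_id t _).const_mul (a * β))).congr_deriv (by ring)
  refine ⟨T, hTt₀, monotoneOn_of_hasDerivWithinAt_nonneg (convex_Ici T)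
    (fun t ht => (hderiv t ht).continuousWithinAt)
    (fun t ht => (hderiv t (interior_subset ht)).mono interior_subset)
    (fun t ht => (hT t (interior_subset ht)).1)⟩

theorem AdmissibleScaling.eventually_forall_tikhonovParam_le (h : AdmissibleScaling a β p t₀ δ)
    (ht₀ : 0 < t₀) (ha : 0 < a) (hβ : 0 ≤ β) :
    ∀ᶠ t in atTop, ∀ s, t ≤ s → tikhonovParam a p δ s ≤ tikhonovParam a p δ t := by
  obtain ⟨T, hTt₀, hmono⟩ := h.exists_monotoneOn_mul_rpow_sub ht₀
  filter_upwards [eventually_ge_atTop T] with t ht s hts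
  have hpos : 0 < δ t * t ^ p :=
    mul_pos (h.pos t (hTt₀.trans ht)) (Real.rpow_pos_of_pos (ht₀.trans_le (hTt₀.trans ht)) p)
  refine div_le_div_of_nonneg_left ha.le hpos ?_
  have := hmono ht (ht.trans hts) hts
  simp only at this
  linarith [mul_le_mul_of_nonneg_left hts (mul_nonneg ha.le hβ)]

theorem AdmissibleScaling.eventually_mul_le (h : AdmissibleScaling a β p t₀ δ) (ht₀ : 0 < t₀)
    (ha : 0 < a) (hβ : 0 < β) : ∀ᶠ t in atTop, a * β / 2 * t ≤ δ t * t ^ p := by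
  obtain ⟨T, hTt₀, hmono⟩ := h.exists_monotoneOn_mul_rpow_sub ht₀
  filter_upwards [eventually_ge_atTop (2 * T)] with t ht
  have hT : 0 < T := ht₀.trans_le hTt₀
  have htT : T ≤ t := by linarith
  have hle := hmono self_mem_Ici htT htT
  have hpos := mul_pos (h.pos T hTt₀) (Real.rpow_pos_of_pos hT p)
  simp only at hle
  linarith [mul_le_mul_of_nonneg_left ht (mul_pos ha hβ).le]

theorem AdmissibleScaling.eventually_mul_tikhonovParam_le (h : AdmissibleScaling a β p t₀ δ)
    (ht₀ : 0 < t₀) (ha : 0 < a) (hβ : 0 < β) :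
    ∀ᶠ t in atTop, β * tikhonovParam a p δ t ≤ 2 * t⁻¹ := by
  filter_upwards [h.eventually_mul_le ht₀ ha hβ, eventually_ge_atTop t₀] with t hle ht
  have ht' : 0 < t := ht₀.trans_le ht
  have hpos : 0 < δ t * t ^ p := mul_pos (h.pos t ht) (Real.rpow_pos_of_pos ht' p)
  rw [tikhonovParam, ← mul_div_assoc, ← div_eq_mul_inv, div_le_div_iff₀ hpos ht']
  linarith

theorem AdmissibleScaling.tendsto_tikhonovParam (h : AdmissibleScaling a β p t₀ δ)
    (ht₀ : 0 < t₀) (ha : 0 < a) (hβ : 0 < β) :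
    Tendsto (tikhonovParam a p δ) atTop (𝓝[>] 0) := by
  have hpos : ∀ᶠ t in atTop, 0 < tikhonovParam a p δ t := by
    filter_upwards [eventually_ge_atTop t₀] with t ht using
      tikhonovParam_pos ha (ht₀.trans_le ht) (h.pos t ht)
  have hbound : Tendsto (fun t : ℝ => 2 * t⁻¹ / β) atTop (𝓝 0) := by
    simpa using (tendsto_inv_atTop_zero.const_mul (2 : ℝ)).div_const β
  refine tendsto_nhdsWithin_iff.2 ⟨?_, hpos⟩
  refine squeeze_zero' (hpos.mono fun t ht => ht.le) ?_ hbound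
  filter_upwards [h.eventually_mul_tikhonovParam_le ht₀ ha hβ] with t ht
  rwa [le_div_iff₀' hβ]

theorem AdmissibleScaling.exists_tikhonovDecayRate_le (h : AdmissibleScaling a β p t₀ δ)
    (ht₀ : 0 < t₀) :
    ∃ K, ∀ᶠ t in atTop,
      timeDeriv t₀ δ t ≤ K * t⁻¹ * δ t ∧ tikhonovDecayRate p t₀ δ t ≤ K * t⁻¹ := by
  obtain ⟨K, hK⟩ := h.upper
  refine ⟨max K (K + p), ?_⟩
  filter_upwards [hK, eventually_ge_atTop t₀] with t hle ht
  have ht' : 0 < t := ht₀.trans_le ht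
  have hδt := h.pos t ht
  have hlog : timeDeriv t₀ δ t / δ t ≤ K * t⁻¹ := by
    rw [div_le_iff₀ hδt, mul_right_comm, ← div_eq_mul_inv, le_div_iff₀' ht']
    exact hle.le
  refine ⟨(div_le_iff₀ hδt).1 (hlog.trans ?_), ?_⟩
  · gcongr
    exact le_max_left _ _
  · calc tikhonovDecayRate p t₀ δ t ≤ K * t⁻¹ + p * t⁻¹ := by
          rw [tikhonovDecayRate, div_eq_mul_inv p]; gcongr
      _ = (K + p) * t⁻¹ := by ring
      _ ≤ max K (K + p) * t⁻¹ := by gcongr; exact le_max_right _ _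

theorem AdmissibleScaling.eventually_tikhonovDecayRate_nonneg (h : AdmissibleScaling a β p t₀ δ)
    (ht₀ : 0 < t₀) (ha : 0 ≤ a) (hβ : 0 ≤ β) :
    ∀ᶠ t in atTop, 0 ≤ tikhonovDecayRate p t₀ δ t := by
  filter_upwards [h.lower, eventually_ge_atTop t₀] with t hlower ht
  have ht' : 0 < t := ht₀.trans_le ht
  have hpos : 0 < δ t * t ^ p := mul_pos (h.pos t ht) (Real.rpow_pos_of_pos ht' p)
  have hδt := h.pos t ht
  refine nonneg_of_mul_nonneg_right ?_ hpos
  calc 0 ≤ t ^ p * timeDeriv t₀ δ t + p * t ^ (p - 1) * δ t := by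
        linarith [mul_nonneg ha hβ]
    _ = δ t * t ^ p * tikhonovDecayRate p t₀ δ t := by
        rw [tikhonovDecayRate, Real.rpow_sub_one ht'.ne']; field_simp

end Coefficients

section Regime

variable {a α β p q t₀ t : ℝ} {δ : ℝ → ℝ}

theorem AdmissibleScaling.eventually_viscosity_mul_le (h : AdmissibleScaling a β p t₀ δ)
    (ht₀ : 0 < t₀) (ha : 0 < a) (hβ : 0 < β) (hpq : p < q + 1) :
    ∀ᶠ t in atTop, α * t ^ (-q) * β ≤ δ t := by
  filter_upwards [h.eventually_mul_le ht₀ ha hβ, eventually_gt_atTop 0,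
    eventually_mul_rpow_le (show p - 1 < q by linarith) (α * β) (show 0 < a * β / 2 by positivity)]
    with t hδ ht hpow
  calc α * t ^ (-q) * β = α * β * t ^ (-q) := by ring
    _ ≤ a * β / 2 * t ^ (-(p - 1)) := hpow
    _ = a * β / 2 * t / t ^ p := by rw [neg_sub, Real.rpow_sub ht, Real.rpow_one]; ring
    _ ≤ δ t := (div_le_iff₀ (Real.rpow_pos_of_pos ht p)).2 hδ

theorem AdmissibleScaling.eventually_dissipativeRegime (h : AdmissibleScaling a β p t₀ δ)
    (ht₀ : 0 < t₀) (ha : 0 < a) (hα : 0 < α) (hβ : 0 < β) (hq : q < 1) (hpq : p < q + 1) :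
    ∀ᶠ t in atTop, DissipativeRegime β (δ t) (timeDeriv t₀ δ t) (tikhonovParam a p δ t)
      (α * t ^ (-q)) (α * (-q * t ^ (-q - 1))) := by
  obtain ⟨K, hK⟩ := h.exists_tikhonovDecayRate_le ht₀
  filter_upwards [eventually_ge_atTop t₀, h.eventually_viscosity_mul_le (α := α) ht₀ ha hβ hpq, hK,
    h.eventually_mul_tikhonovParam_le ht₀ ha hβ,
    eventually_mul_rpow_le hq 2 (show 0 < α / 32 by positivity),
    eventually_mul_rpow_le hq K (show 0 < α / 4 by positivity),
    eventually_mul_rpow_le (show p < 2 by linarith) (q ^ 2) (show 0 < a / 32 by positivity),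
    eventually_mul_rpow_le hpq (|q| * α) (show 0 < a / 16 by positivity)]
    with t ht hγβ hδ' hβε hinv hinvK hsq habs
  have ht' : 0 < t := ht₀.trans_le ht
  have hδt := h.pos t ht
  have hγ : 0 < α * t ^ (-q) := mul_pos hα (Real.rpow_pos_of_pos ht' _)
  have hμ := mul_tikhonovParam (a := a) (p := p) ht' hδt
  rw [Real.rpow_neg_one] at hinv hinvK
  refine ⟨hβ.le, hδt, tikhonovParam_pos ha ht' hδt, hγ, hγβ, by linarith, ?_, ?_, ?_⟩
  · exact hδ'.1.trans (by gcongr; linarith)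
  · have hγ' : α * (-q * t ^ (-q - 1)) = -(α * t ^ (-q) * (q * t⁻¹)) := by
      rw [Real.rpow_sub_one ht'.ne']; ring
    have hinv_sq : t⁻¹ ^ 2 = t ^ (-2 : ℝ) := by
      rw [Real.rpow_neg ht'.le, Real.rpow_two, inv_pow]
    rw [hγ', neg_sq, mul_pow, mul_pow q, hinv_sq, hμ]
    gcongr
    linarith
  · have hexp : t ^ (-q - 1) = t ^ (-(q + 1)) := by rw [neg_add']
    rw [hμ, abs_mul, abs_mul, abs_neg, abs_of_pos hα,
      abs_of_pos (Real.rpow_pos_of_pos ht' _), hexp]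
    linarith

theorem mul_rpow_neg_le_viscosity {c m : ℝ} (hα : 0 < α) (hc : 0 ≤ c) (hcα : c ≤ α / 4)
    (hca : c * α ≤ a / 8) (ht : 1 ≤ t) (hqm : q ≤ m) (hpm : p - q ≤ m) :
    c * t ^ (-m) ≤ α * t ^ (-q) / 4 ∧ c * t ^ (-m) * (α * t ^ (-q)) ≤ a * t ^ (-p) / 8 := by
  have ht' : 0 < t := by linarith
  constructor
  · calc c * t ^ (-m) ≤ α / 4 * t ^ (-q) := by gcongr
      _ = α * t ^ (-q) / 4 := by ring
  · have hpow : t ^ (-m) * t ^ (-q) ≤ t ^ (-p) := by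
      rw [← Real.rpow_add ht']
      exact Real.rpow_le_rpow_of_exponent_le ht (by linarith)
    calc c * t ^ (-m) * (α * t ^ (-q)) = c * α * (t ^ (-m) * t ^ (-q)) := by ring
      _ ≤ a / 8 * t ^ (-p) := by gcongr; exact (mul_nonneg hc hα.le).trans hca
      _ = a * t ^ (-p) / 8 := by ring

theorem forcing_le_rpow {l K ρ b : ℝ} (hα : 0 < α) (ha : 0 < a) (ht : 1 ≤ t) (hb : b ≤ 2 * t⁻¹)
    (hρ : 0 ≤ ρ) (hρK : ρ ≤ K * t⁻¹) (hl₁ : l ≤ p + 1) (hl₂ : l ≤ q + 2)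
    (hl₃ : l ≤ 3 * q + 2 - p) :
    a * t ^ (-p) * (b + ρ / 2)
        + α * t ^ (-q) * ρ ^ 2 * (1 / 2 + (α * t ^ (-q)) ^ 2 / (a * t ^ (-p)))
      ≤ (a * (2 + K / 2) + α * K ^ 2 / 2 + α ^ 3 * K ^ 2 / a) * t ^ (-l) := by
  have ht' : 0 < t := by linarith
  have hK : 0 ≤ K := nonneg_of_mul_nonneg_left (hρ.trans hρK) (inv_pos.2 ht')
  have hpow₁ : t ^ (-p) * t⁻¹ ≤ t ^ (-l) := by
    rw [← Real.rpow_neg_one, ← Real.rpow_add ht']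
    exact Real.rpow_le_rpow_of_exponent_le ht (by linarith)
  have hpow₂ : t ^ (-q) * t⁻¹ ^ 2 ≤ t ^ (-l) := by
    rw [inv_pow, ← Real.rpow_two, ← Real.rpow_neg ht'.le, ← Real.rpow_add ht']
    exact Real.rpow_le_rpow_of_exponent_le ht (by linarith)
  have hpow₃ : t ^ (-(3 * q)) * t⁻¹ ^ 2 / t ^ (-p) ≤ t ^ (-l) := by
    rw [inv_pow, ← Real.rpow_two, ← Real.rpow_neg ht'.le, ← Real.rpow_add ht', ← Real.rpow_sub ht']
    exact Real.rpow_le_rpow_of_exponent_le ht (by linarith)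
  have hcube : t ^ (-(3 * q)) = (t ^ (-q)) ^ 3 := by
    rw [← Real.rpow_mul_natCast ht'.le]; congr 1; push_cast; ring
  calc _ ≤ a * t ^ (-p) * (2 * t⁻¹ + K * t⁻¹ / 2)
        + α * t ^ (-q) * (K * t⁻¹) ^ 2 * (1 / 2 + (α * t ^ (-q)) ^ 2 / (a * t ^ (-p))) := by
        gcongr
    _ = a * (2 + K / 2) * (t ^ (-p) * t⁻¹) + α * K ^ 2 / 2 * (t ^ (-q) * t⁻¹ ^ 2)
        + α ^ 3 * K ^ 2 / a * (t ^ (-(3 * q)) * t⁻¹ ^ 2 / t ^ (-p)) := by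
        rw [hcube]; field_simp; ring
    _ ≤ a * (2 + K / 2) * t ^ (-l) + α * K ^ 2 / 2 * t ^ (-l) + α ^ 3 * K ^ 2 / a * t ^ (-l) := by
        gcongr
    _ = _ := by ring

end Regime

section Trajectory

variable {X : Type*} [NormedAddCommGroup X] [InnerProductSpace ℝ X] [CompleteSpace X]

/-- The shifted velocity `x' + β ∇g(x)`. Its derivative involves no Hessian of `g`. -/
noncomputable def shiftedVelocity (g : X → ℝ) (β t₀ : ℝ) (x : ℝ → X) (t : ℝ) : X :=
  timeDeriv t₀ x t + β • gradient g (x t)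

/-- The energy along a trajectory `x`, with `z` the path of Tikhonov minimizers. -/
noncomputable def trajectoryEnergy (g : X → ℝ) (α β a p q t₀ : ℝ) (δ : ℝ → ℝ) (x z : ℝ → X)
    (t : ℝ) : ℝ :=
  energy g (δ t) (tikhonovParam a p δ t) (α * t ^ (-q)) (x t) (shiftedVelocity g β t₀ x t)
    (z (tikhonovParam a p δ t))

/-- The exponent of decay of the energy: the source term is of order
`t ^ (-min (p + 1) (3 * q + 2 - p))` and the dissipation rate of order `t ^ (-max q (p - q))`. -/
noncomputable def decayExponent (p q : ℝ) : ℝ :=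
  min (p + 1) (3 * q + 2 - p) - max q (p - q)

variable {g : X → ℝ} {α β a p q t₀ t : ℝ} {δ : ℝ → ℝ} {x z : ℝ → X}

theorem AdmissibleScaling.exists_source_le (h : AdmissibleScaling a β p t₀ δ) (ht₀ : 0 < t₀)
    (ha : 0 < a) (hα : 0 < α) (hβ : 0 < β) (hq : q < 1) :
    ∃ C, ∀ᶠ t in atTop,
      δ t * tikhonovParam a p δ t * (β * tikhonovParam a p δ t + tikhonovDecayRate p t₀ δ t / 2)
        + α * t ^ (-q) * tikhonovDecayRate p t₀ δ t ^ 2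
          * (1 / 2 + (α * t ^ (-q)) ^ 2 / (δ t * tikhonovParam a p δ t))
      ≤ C * t ^ (-(decayExponent p q + max q (p - q))) := by
  obtain ⟨K, hK⟩ := h.exists_tikhonovDecayRate_le ht₀
  have hsum : decayExponent p q + max q (p - q) = min (p + 1) (3 * q + 2 - p) :=
    sub_add_cancel _ _
  have hle₁ := min_le_left (p + 1) (3 * q + 2 - p)
  have hle₃ := min_le_right (p + 1) (3 * q + 2 - p)
  refine ⟨a * (2 + K / 2) + α * K ^ 2 / 2 + α ^ 3 * K ^ 2 / a, ?_⟩
  filter_upwards [hK, h.eventually_tikhonovDecayRate_nonneg ht₀ ha.le hβ.le,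
    h.eventually_mul_tikhonovParam_le ht₀ ha hβ, eventually_ge_atTop t₀, eventually_ge_atTop 1]
    with t hK hρ hβε ht ht1
  rw [mul_tikhonovParam (ht₀.trans_le ht) (h.pos t ht), hsum]
  exact forcing_le_rpow hα ha ht1 hβε hρ hK.2 hle₁ (by linarith) hle₃

theorem IsGlobalSolution.hasDerivWithinAt (hx : IsGlobalSolution g α β a p q t₀ δ x)
    (ht : t₀ ≤ t) : HasDerivWithinAt x (timeDeriv t₀ x t) (Ici t₀) t :=
  (hx.differentiable t ht).hasDerivWithinAt

theorem IsGlobalSolution.hasDerivWithinAt_shiftedVelocity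
    (hx : IsGlobalSolution g α β a p q t₀ δ x) (ht : t₀ ≤ t) (ht' : 0 < t) (hδ : 0 < δ t) :
    HasDerivWithinAt (shiftedVelocity g β t₀ x)
      (-((α * t ^ (-q)) • timeDeriv t₀ x t)
        - δ t • (gradient g (x t) + tikhonovParam a p δ t • x t)) (Ici t₀) t := by
  have hvelocity : HasDerivWithinAt (timeDeriv t₀ x) (timeDeriv t₀ (timeDeriv t₀ x) t)
      (Ici t₀) t := (hx.differentiable_velocity t ht).hasDerivWithinAt
  have hgradient : HasDerivWithinAt (fun s => gradient g (x s))
      (hessian g (x t) (timeDeriv t₀ x t)) (Ici t₀) t :=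
    (hx.differentiable_gradient t ht).hasFDerivAt.comp_hasDerivWithinAt t (hx.hasDerivWithinAt ht)
  refine (hvelocity.add (hgradient.const_smul β)).congr_deriv (sub_eq_zero.1 ?_)
  rw [← hx.equation t ht, smul_add, smul_smul, mul_tikhonovParam ht' hδ, Real.rpow_neg ht'.le,
    Real.rpow_neg ht'.le, ← div_eq_mul_inv, ← div_eq_mul_inv]
  abel

theorem IsGlobalSolution.continuousOn_trajectoryEnergy
    (hx : IsGlobalSolution g α β a p q t₀ δ x) (hg : ConvexOn ℝ univ g) (hd : Differentiable ℝ g)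
    (hne : (argmin g).Nonempty) (hz : IsTikhonovPath g z) (ha : 0 < a) (ht₀ : 0 < t₀)
    (hδ_pos : ∀ t, t₀ ≤ t → 0 < δ t) (hδ : DifferentiableOn ℝ δ (Ici t₀)) :
    ContinuousOn (trajectoryEnergy g α β a p q t₀ δ x z) (Ici t₀) := by
  have hpos : ∀ t ∈ Ici t₀, 0 < t := fun t ht => ht₀.trans_le ht
  have hε : ContinuousOn (tikhonovParam a p δ) (Ici t₀) := fun t ht =>
    (hasDerivWithinAt_tikhonovParam (hpos t ht) (hδ_pos t ht).ne' (hδ t ht)).continuousWithinAt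
  have hγ : ContinuousOn (fun t : ℝ => α * t ^ (-q)) (Ici t₀) :=
    continuousOn_const.mul (continuousOn_id.rpow_const fun t ht => Or.inl (hpos t ht).ne')
  have hxc : ContinuousOn x (Ici t₀) := hx.differentiable.continuousOn
  have hv : ContinuousOn (shiftedVelocity g β t₀ x) (Ici t₀) := fun t ht =>
    (hx.hasDerivWithinAt_shiftedVelocity ht (hpos t ht) (hδ_pos t ht)).continuousWithinAt
  have hzc : ContinuousOn (fun t => z (tikhonovParam a p δ t)) (Ici t₀) :=
    (hz.continuousOn hg hne).comp hε fun t ht => tikhonovParam_pos ha (hpos t ht) (hδ_pos t ht)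
  have hpenalized : ∀ {u : ℝ → X}, ContinuousOn u (Ici t₀) →
      ContinuousOn (fun t => penalized g (tikhonovParam a p δ t) (u t)) (Ici t₀) := fun hu =>
    (hd.continuous.comp_continuousOn hu).add ((hε.div_const 2).mul (hu.norm.pow 2))
  exact ((hδ.continuousOn.mul ((hpenalized hxc).sub (hpenalized hzc))).add
    (continuousOn_const.mul (hv.norm.pow 2))).add
    (continuousOn_const.mul ((hv.add (hγ.smul (hxc.sub hzc))).norm.pow 2))

theorem IsGlobalSolution.eventually_lowerDiniLE_trajectoryEnergy
    (hx : IsGlobalSolution g α β a p q t₀ δ x) (hg : ConvexOn ℝ univ g) (hd : Differentiable ℝ g)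
    {M : ℝ} (hM : ∀ ε, 0 < ε → ‖z ε‖ ≤ M) (hz : IsTikhonovPath g z) (hα : 0 ≤ α) (hβ : 0 ≤ β)
    (ha : 0 < a) (ht₀ : 0 < t₀) (hδ : AdmissibleScaling a β p t₀ δ) :
    ∀ᶠ t in atTop, LowerDiniLE (trajectoryEnergy g α β a p q t₀ δ x z) t
      (energyRate g (δ t) (timeDeriv t₀ δ t) (tikhonovParam a p δ t) (tikhonovDecayRate p t₀ δ t)
        (α * t ^ (-q)) (α * (-q * t ^ (-q - 1))) M (x t) (timeDeriv t₀ x t)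
        (shiftedVelocity g β t₀ x t)
        (-((α * t ^ (-q)) • timeDeriv t₀ x t)
          - δ t • (gradient g (x t) + tikhonovParam a p δ t • x t))
        (z (tikhonovParam a p δ t))) := by
  filter_upwards [hδ.eventually_forall_tikhonovParam_le ht₀ ha hβ, eventually_ge_atTop t₀]
    with t hanti ht
  have hpos : ∀ s, t ≤ s → 0 < s := fun s hs => ht₀.trans_le (ht.trans hs)
  have hδt := hδ.pos t ht
  have ht' := hpos t le_rfl
  have hsub : Ici t ⊆ Ici t₀ := Ici_subset_Ici.2 ht
  exact hz.lowerDiniLE_energy hg hd hM (fun s hs => (hδ.pos s (ht.trans hs)).le)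
    (fun s hs => mul_nonneg hα (Real.rpow_nonneg (hpos s hs).le _))
    (fun s hs => tikhonovParam_pos ha (hpos s hs) (hδ.pos s (ht.trans hs))) hanti
    ((hδ.differentiableOn t ht).hasDerivWithinAt.mono hsub)
    ((hasDerivWithinAt_tikhonovParam ht' hδt.ne' (hδ.differentiableOn t ht)).mono hsub)
    ((Real.hasDerivAt_rpow_const (Or.inl ht'.ne')).const_mul α).hasDerivWithinAt
    ((hx.hasDerivWithinAt ht).mono hsub)
    ((hx.hasDerivWithinAt_shiftedVelocity ht ht' hδt).mono hsub)

theorem IsGlobalSolution.exists_lowerDiniLE_trajectoryEnergy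
    (hx : IsGlobalSolution g α β a p q t₀ δ x) (hg : ConvexOn ℝ univ g) (hd : Differentiable ℝ g)
    (hne : (argmin g).Nonempty) (hz : IsTikhonovPath g z) (hα : 0 < α) (hβ : 0 < β) (ha : 0 < a)
    (ht₀ : 0 < t₀) (hq : q < 1) (hpq : p < q + 1) (hδ : AdmissibleScaling a β p t₀ δ) :
    ∃ c C, 0 < c ∧ ∀ᶠ t in atTop, LowerDiniLE (trajectoryEnergy g α β a p q t₀ δ x z) t
      (-(c * t ^ (-max q (p - q))) * trajectoryEnergy g α β a p q t₀ δ x z t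
        + C * t ^ (-(decayExponent p q + max q (p - q)))) := by
  obtain ⟨y, hy⟩ := hne
  have hM : ∀ ε, 0 < ε → ‖z ε‖ ≤ ‖y‖ := fun ε hε => hz.norm_le hε hy
  obtain ⟨C, hC⟩ := hδ.exists_source_le ht₀ ha hα hβ hq
  have hc : 0 < min (α / 4) (a / 8 / α) := by positivity
  refine ⟨min (α / 4) (a / 8 / α), C * ‖y‖ ^ 2, hc, ?_⟩
  filter_upwards [hx.eventually_lowerDiniLE_trajectoryEnergy hg hd hM hz hα.le hβ.le ha ht₀ hδ, hC,
    hδ.eventually_dissipativeRegime ht₀ ha hα hβ hq hpq,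
    hδ.eventually_tikhonovDecayRate_nonneg ht₀ ha.le hβ.le, eventually_ge_atTop t₀,
    eventually_ge_atTop 1] with t hdini hC hregime hρ ht ht1
  have ht' : 0 < t := ht₀.trans_le ht
  have hε := hregime.ε_pos
  obtain ⟨hrγ, hrμ⟩ := mul_rpow_neg_le_viscosity hα hc.le (min_le_left _ _)
    ((le_div_iff₀ hα).1 (min_le_right _ _)) ht1 (le_max_left q (p - q)) (le_max_right q (p - q))
  rw [← mul_tikhonovParam (a := a) (p := p) ht' (hδ.pos t ht)] at hrμ
  have hx' : timeDeriv t₀ x t = shiftedVelocity g β t₀ x t - β • gradient g (x t) :=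
    (add_sub_cancel_right _ _).symm
  refine hdini.mono ((hregime.energyRate_le hg hd (hz _ hε) (hM _ hε) hρ
    (mul_nonneg hc.le (Real.rpow_nonneg ht'.le _)) hrγ hrμ hx' rfl).trans ?_)
  rw [mul_right_comm C]
  exact add_le_add le_rfl (mul_le_mul_of_nonneg_right hC (sq_nonneg ‖y‖))

theorem IsGlobalSolution.exists_trajectoryEnergy_le
    (hx : IsGlobalSolution g α β a p q t₀ δ x) (hg : ConvexOn ℝ univ g) (hd : Differentiable ℝ g)
    (hne : (argmin g).Nonempty) (hz : IsTikhonovPath g z) (hα : 0 < α) (hβ : 0 < β) (ha : 0 < a)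
    (ht₀ : 0 < t₀) (hq : q < 1) (hpq : p < q + 1) (hδ : AdmissibleScaling a β p t₀ δ) :
    ∃ B, ∀ᶠ t in atTop,
      trajectoryEnergy g α β a p q t₀ δ x z t ≤ B * t ^ (-decayExponent p q) := by
  obtain ⟨c, C, hc, hdini⟩ :=
    hx.exists_lowerDiniLE_trajectoryEnergy hg hd hne hz hα hβ ha ht₀ hq hpq hδ
  exact exists_le_mul_rpow_of_lowerDiniLE hc (max_lt hq (by linarith))
    (hx.continuousOn_trajectoryEnergy hg hd hne hz ha ht₀ hδ.pos hδ.differentiableOn) hdini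

end Trajectory

section Rates

variable {X : Type*} [NormedAddCommGroup X] [InnerProductSpace ℝ X]
  {g : X → ℝ} {α β a p q t₀ k e B : ℝ} {δ : ℝ → ℝ} {x z : ℝ → X}

theorem decayExponent_of_le (h : p ≤ (3 * q + 1) / 2) :
    decayExponent p q = p + 1 - max q (p - q) := by
  rw [decayExponent, min_eq_left (by linarith)]

theorem decayExponent_of_ge (hq : q ≤ 1) (h : (3 * q + 1) / 2 ≤ p) :
    decayExponent p q = 4 * q - 2 * p + 2 := by
  rw [decayExponent, min_eq_right (by linarith), max_eq_right (by linarith)]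
  ring

theorem decayExponent_sub_min (p q : ℝ) :
    decayExponent p q - min (2 * q) p = min (1 - q) (2 * (q - p + 1)) := by
  have hmin : min (2 * q) p = q + min q (p - q) := by
    rw [← min_add_add_left]; ring_nf
  have hmin' : min (p + 1) (3 * q + 2 - p) = p + q + min (1 - q) (2 * (q - p + 1)) := by
    rw [← min_add_add_left]; ring_nf
  rw [decayExponent, hmin, hmin']
  linarith [min_add_max q (p - q)]

theorem isBigO_one_div_rpow_of_sq_le {f : ℝ → ℝ} {C : ℝ} (he : 2 * e ≤ k)
    (h : ∀ᶠ t in atTop, f t ^ 2 ≤ C * t ^ (-k)) : f =O[atTop] fun t => 1 / t ^ e := by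
  refine IsBigO.of_pow two_ne_zero (IsBigO.of_bound (max C 0) ?_)
  filter_upwards [h, eventually_ge_atTop 1] with t hf ht
  have ht' : 0 < t := by linarith
  have hsq : (1 / t ^ e) ^ 2 = t ^ (-(2 * e)) := by
    rw [one_div, ← Real.rpow_neg ht'.le, ← Real.rpow_mul_natCast ht'.le]
    congr 1; push_cast; ring
  rw [Pi.pow_apply, Pi.pow_apply, hsq, Real.norm_of_nonneg (sq_nonneg _),
    Real.norm_of_nonneg (Real.rpow_nonneg ht'.le _)]
  calc f t ^ 2 ≤ C * t ^ (-k) := hf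
    _ ≤ max C 0 * t ^ (-(2 * e)) := by
      gcongr
      exact le_max_left _ _

theorem isBigO_one_div_mul_rpow {f : ℝ → ℝ} {C : ℝ} (hf : ∀ t, 0 ≤ f t)
    (h : ∀ᶠ t in atTop, 0 < δ t ∧ δ t * f t ≤ C * t ^ (-e)) :
    f =O[atTop] fun t => 1 / (δ t * t ^ e) := by
  refine IsBigO.of_bound C ?_
  filter_upwards [h, eventually_gt_atTop 0] with t ⟨hδ, hle⟩ ht
  have : 0 < t ^ e := Real.rpow_pos_of_pos ht e
  rw [Real.norm_of_nonneg (hf t), Real.norm_of_nonneg (by positivity), mul_one_div,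
    le_div_iff₀ (by positivity)]
  calc f t * (δ t * t ^ e) = δ t * f t * t ^ e := by ring
    _ ≤ C * t ^ (-e) * t ^ e := by gcongr
    _ = C := by rw [mul_assoc, ← Real.rpow_add ht, neg_add_cancel, Real.rpow_zero, mul_one]

theorem tendsto_norm_sub_zero_of_isBigO {E : Type*} [SeminormedAddCommGroup E] {x y : ℝ → E}
    {xbar : E} (he : 0 < e) (hxy : (fun t => ‖x t - y t‖) =O[atTop] fun t => 1 / t ^ e)
    (hy : Tendsto y atTop (𝓝 xbar)) : Tendsto (fun t => ‖x t - xbar‖) atTop (𝓝 0) := by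
  have hpow : Tendsto (fun t : ℝ => 1 / t ^ e) atTop (𝓝 0) :=
    (tendsto_rpow_atTop he).inv_tendsto_atTop.congr fun t => (one_div _).symm
  have hdiff : Tendsto (fun t => x t - y t) atTop (𝓝 0) :=
    tendsto_zero_iff_norm_tendsto_zero.2 (hxy.trans_tendsto hpow)
  rw [← tendsto_iff_norm_sub_tendsto_zero]
  simpa only [sub_add_cancel, zero_add] using hdiff.add hy

variable [CompleteSpace X]

theorem isBigO_norm_shiftedVelocity (hz : IsTikhonovPath g z) (ha : 0 < a) (ht₀ : 0 < t₀)
    (hδ : ∀ t, t₀ ≤ t → 0 < δ t) (he : 2 * e ≤ k)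
    (hE : ∀ᶠ t in atTop, trajectoryEnergy g α β a p q t₀ δ x z t ≤ B * t ^ (-k)) :
    (fun t => ‖shiftedVelocity g β t₀ x t‖) =O[atTop] fun t => 1 / t ^ e := by
  refine isBigO_one_div_rpow_of_sq_le (C := 4 * B) he ?_
  filter_upwards [hE, eventually_ge_atTop t₀] with t hE ht
  have hε := tikhonovParam_pos (p := p) ha (ht₀.trans_le ht) (hδ t ht)
  calc ‖shiftedVelocity g β t₀ x t‖ ^ 2 ≤ 4 * trajectoryEnergy g α β a p q t₀ δ x z t :=
        norm_sq_le_energy (hδ t ht).le (hz _ hε)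
    _ ≤ 4 * B * t ^ (-k) := by linarith

theorem eventually_norm_sub_sq_le_of_viscosity (hz : IsTikhonovPath g z) (hα : 0 < α) (ha : 0 < a)
    (ht₀ : 0 < t₀) (hδ : ∀ t, t₀ ≤ t → 0 < δ t)
    (hE : ∀ᶠ t in atTop, trajectoryEnergy g α β a p q t₀ δ x z t ≤ B * t ^ (-k)) :
    ∀ᶠ t in atTop, ‖x t - z (tikhonovParam a p δ t)‖ ^ 2 ≤ 8 * B / α ^ 2 * t ^ (-(k - 2 * q)) := by
  filter_upwards [hE, eventually_ge_atTop t₀] with t hE ht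
  have ht' : 0 < t := ht₀.trans_le ht
  have hε := tikhonovParam_pos (p := p) ha ht' (hδ t ht)
  have hγ : 0 < (α * t ^ (-q)) ^ 2 := by positivity
  have hpow : t ^ (-(k - 2 * q)) * (t ^ (-q)) ^ 2 = t ^ (-k) := by
    rw [← Real.rpow_mul_natCast ht'.le, ← Real.rpow_add ht']
    congr 1; push_cast; ring
  refine le_of_mul_le_mul_left ?_ hγ
  calc (α * t ^ (-q)) ^ 2 * ‖x t - z (tikhonovParam a p δ t)‖ ^ 2
      ≤ 8 * trajectoryEnergy g α β a p q t₀ δ x z t :=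
        sq_mul_norm_sub_sq_le_energy (hδ t ht).le (hz _ hε)
    _ ≤ 8 * B * (t ^ (-(k - 2 * q)) * (t ^ (-q)) ^ 2) := by rw [hpow]; linarith
    _ = (α * t ^ (-q)) ^ 2 * (8 * B / α ^ 2 * t ^ (-(k - 2 * q))) := by field_simp

theorem eventually_norm_sub_sq_le_of_growth (hz : IsTikhonovPath g z) (hg : ConvexOn ℝ univ g)
    (ha : 0 < a) (ht₀ : 0 < t₀) (hδ : ∀ t, t₀ ≤ t → 0 < δ t)
    (hE : ∀ᶠ t in atTop, trajectoryEnergy g α β a p q t₀ δ x z t ≤ B * t ^ (-k)) :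
    ∀ᶠ t in atTop, ‖x t - z (tikhonovParam a p δ t)‖ ^ 2 ≤ 2 * B / a * t ^ (-(k - p)) := by
  filter_upwards [hE, eventually_ge_atTop t₀] with t hE ht
  have ht' : 0 < t := ht₀.trans_le ht
  have hδt := hδ t ht
  have hμ : 0 < a * t ^ (-p) / 2 := by positivity
  have hpow : t ^ (-(k - p)) * t ^ (-p) = t ^ (-k) := by
    rw [← Real.rpow_add ht']; congr 1; ring
  refine le_of_mul_le_mul_left ?_ hμ
  calc a * t ^ (-p) / 2 * ‖x t - z (tikhonovParam a p δ t)‖ ^ 2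
      ≤ trajectoryEnergy g α β a p q t₀ δ x z t := by
        rw [← mul_tikhonovParam ht' hδt]
        exact mul_norm_sub_sq_le_energy hg hδt.le (hz _ (tikhonovParam_pos ha ht' hδt))
    _ ≤ B * (t ^ (-(k - p)) * t ^ (-p)) := by rwa [hpow]
    _ = a * t ^ (-p) / 2 * (2 * B / a * t ^ (-(k - p))) := by field_simp

theorem isBigO_norm_sub (hz : IsTikhonovPath g z) (hg : ConvexOn ℝ univ g) (hα : 0 < α)
    (ha : 0 < a) (ht₀ : 0 < t₀) (hδ : ∀ t, t₀ ≤ t → 0 < δ t) (he : 2 * e ≤ k - min (2 * q) p)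
    (hE : ∀ᶠ t in atTop, trajectoryEnergy g α β a p q t₀ δ x z t ≤ B * t ^ (-k)) :
    (fun t => ‖x t - z (tikhonovParam a p δ t)‖) =O[atTop] fun t => 1 / t ^ e := by
  rcases min_choice (2 * q) p with hmin | hmin <;> rw [hmin] at he
  · exact isBigO_one_div_rpow_of_sq_le he
      (eventually_norm_sub_sq_le_of_viscosity hz hα ha ht₀ hδ hE)
  · exact isBigO_one_div_rpow_of_sq_le he
      (eventually_norm_sub_sq_le_of_growth hz hg ha ht₀ hδ hE)

theorem isBigO_sub_of_mem_argmin (hz : IsTikhonovPath g z) (ha : 0 < a) (ht₀ : 0 < t₀)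
    (hδ : ∀ t, t₀ ≤ t → 0 < δ t) {y : X} (hy : y ∈ argmin g) (hek : e ≤ k) (hep : e ≤ p)
    (hE : ∀ᶠ t in atTop, trajectoryEnergy g α β a p q t₀ δ x z t ≤ B * t ^ (-k)) :
    (fun t => g (x t) - g y) =O[atTop] fun t => 1 / (δ t * t ^ e) := by
  refine isBigO_one_div_mul_rpow (C := max B 0 + a / 2 * ‖y‖ ^ 2)
    (fun t => sub_nonneg.2 (hy (x t))) ?_
  filter_upwards [hE, eventually_ge_atTop t₀, eventually_ge_atTop 1] with t hE ht ht1
  have ht' : 0 < t := ht₀.trans_le ht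
  have hε := tikhonovParam_pos (p := p) ha ht' (hδ t ht)
  refine ⟨hδ t ht, ?_⟩
  calc δ t * (g (x t) - g y)
      ≤ trajectoryEnergy g α β a p q t₀ δ x z t + δ t * tikhonovParam a p δ t / 2 * ‖y‖ ^ 2 :=
        mul_sub_le_energy_add (hδ t ht).le hε.le (hz _ hε) y
    _ ≤ max B 0 * t ^ (-k) + a * t ^ (-p) / 2 * ‖y‖ ^ 2 := by
        rw [mul_tikhonovParam ht' (hδ t ht)]
        exact add_le_add (hE.trans (by gcongr; exact le_max_left _ _)) le_rfl
    _ ≤ max B 0 * t ^ (-e) + a * t ^ (-e) / 2 * ‖y‖ ^ 2 := by gcongr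
    _ = (max B 0 + a / 2 * ‖y‖ ^ 2) * t ^ (-e) := by ring

end Rates

end TikhonovHessian

theorem theorem3p4_general
    {X : Type*} [NormedAddCommGroup X] [InnerProductSpace ℝ X] [CompleteSpace X]
    (g : X → ℝ) (hg_convex : ConvexOn ℝ univ g) (hg_diff : Differentiable ℝ g)
    (hg_argmin : (TikhonovHessian.argmin g).Nonempty)
    (α β a p q t₀ : ℝ) (hα : 0 < α) (hβ : 0 < β) (ha : 0 < a) (ht₀ : 0 < t₀)
    (hq : q < 1) (hpq : p < q + 1)
    (δ : ℝ → ℝ) (hδ : TikhonovHessian.AdmissibleScaling a β p t₀ δ)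
    (x : ℝ → X) (hx : TikhonovHessian.IsGlobalSolution g α β a p q t₀ δ x) :
    ∃ (xbar : X) (xreg : ℝ → X),
      (∀ z, TikhonovHessian.IsMinNormMinimizer g z ↔ z = xbar) ∧
      (∀ t, t₀ ≤ t → ∀ z,
        z ∈ TikhonovHessian.argmin (TikhonovHessian.regularized g a p δ t) ↔ z = xreg t) ∧
      Tendsto (fun t => ‖x t - xbar‖) atTop (𝓝 0) ∧
      (p < (3 * q + 1) / 2 →
        ((fun t => ‖TikhonovHessian.timeDeriv t₀ x t + β • gradient g (x t)‖)
            =O[atTop] fun t => 1 / t ^ ((p + 1 - max q (p - q)) / 2)) ∧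
        ((fun t => ‖x t - xreg t‖) =O[atTop] fun t => 1 / t ^ ((1 - q) / 2)) ∧
        ((fun t => g (x t) - g xbar) =O[atTop] fun t => 1 / (δ t * t ^ p))) ∧
      ((3 * q + 1) / 2 ≤ p →
        ((fun t => ‖TikhonovHessian.timeDeriv t₀ x t + β • gradient g (x t)‖)
            =O[atTop] fun t => 1 / t ^ (2 * q - p + 1)) ∧
        ((fun t => ‖x t - xreg t‖) =O[atTop] fun t => 1 / t ^ (q - p + 1)) ∧
        (p ≤ (4 * q + 2) / 3 →
          (fun t => g (x t) - g xbar) =O[atTop] fun t => 1 / (δ t * t ^ p)) ∧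
        ((4 * q + 2) / 3 < p →
          (fun t => g (x t) - g xbar)
            =O[atTop] fun t => 1 / (δ t * t ^ (4 * q - 2 * p + 2)))) := by
  obtain ⟨xbar, hxbar⟩ :=
    TikhonovHessian.exists_isMinNormMinimizer hg_convex hg_diff.continuous hg_argmin
  obtain ⟨z, hz⟩ :=
    TikhonovHessian.exists_isTikhonovPath hg_convex hg_diff.continuous hg_argmin
  obtain ⟨B, hE⟩ :=
    hx.exists_trajectoryEnergy_le hg_convex hg_diff hg_argmin hz hα hβ ha ht₀ hq hpq hδ
  have velocity_rate {e : ℝ} (he : 2 * e ≤ TikhonovHessian.decayExponent p q) :=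
    TikhonovHessian.isBigO_norm_shiftedVelocity hz ha ht₀ hδ.pos he hE
  have distance_rate {e : ℝ} (he : 2 * e ≤ min (1 - q) (2 * (q - p + 1))) :=
    TikhonovHessian.isBigO_norm_sub hz hg_convex hα ha ht₀ hδ.pos
      (he.trans_eq (TikhonovHessian.decayExponent_sub_min p q).symm) hE
  have value_rate {e : ℝ} (he : e ≤ TikhonovHessian.decayExponent p q) (hep : e ≤ p) :=
    TikhonovHessian.isBigO_sub_of_mem_argmin hz ha ht₀ hδ.pos hxbar.1 he hep hE
  refine ⟨xbar, fun t => z (TikhonovHessian.tikhonovParam a p δ t),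
    fun y => ⟨fun hy => hy.eq hg_convex hxbar, fun hy => hy ▸ hxbar⟩, fun t ht y => ?_,
    TikhonovHessian.tendsto_norm_sub_zero_of_isBigO
      (half_pos (lt_min (sub_pos.2 hq) (by linarith : 0 < 2 * (q - p + 1))))
      (distance_rate (mul_div_cancel₀ _ two_ne_zero).le)
      ((hz.tendsto hg_convex hg_diff.continuous hxbar).comp
        (hδ.tendsto_tikhonovParam ht₀ ha hβ)), fun hp => ?_, fun hp => ?_⟩
  · rw [TikhonovHessian.regularized_eq_penalized]
    exact hz.mem_argmin_penalized_iff hg_convex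
      (TikhonovHessian.tikhonovParam_pos ha (ht₀.trans_le ht) (hδ.pos t ht))
  · have hk := TikhonovHessian.decayExponent_of_le hp.le
    refine ⟨velocity_rate (by linarith), distance_rate (le_min (by linarith) (by linarith)),
      value_rate ?_ le_rfl⟩
    linarith [max_le hq.le (by linarith : p - q ≤ 1)]
  · have hk := TikhonovHessian.decayExponent_of_ge hq.le hp
    exact ⟨velocity_rate (by linarith), distance_rate (le_min (by linarith) le_rfl),
      fun hp' => value_rate (by linarith) le_rfl, fun hp' => value_rate hk.ge (by linarith)⟩

theorem theorem3p4
    {X : Type*} [NormedAddCommGroup X] [InnerProductSpace ℝ X] [CompleteSpace X]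
    (g : X → ℝ) (hg_convex : ConvexOn ℝ univ g) (hg_diff : Differentiable ℝ g)
    (hg_argmin : (TikhonovHessian.argmin g).Nonempty)
    (α β a p q t₀ : ℝ) (hα : 0 < α) (hβ : 0 < β) (ha : 0 < a) (ht₀ : 0 < t₀)
    (hq_pos : 0 < q) (hq_lt : q < 1) (hqp : q < p) (hpq : p < q + 1)
    (δ : ℝ → ℝ) (hδ_pos : ∀ t, t₀ ≤ t → 0 < δ t) (hδ_mono : MonotoneOn δ (Ici t₀))
    (hδ_diff : DifferentiableOn ℝ δ (Ici t₀)) (hδ_lim : Tendsto δ atTop atTop)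
    (hδ_lower : ∀ᶠ t in atTop,
      0 ≤ t ^ p * TikhonovHessian.timeDeriv t₀ δ t + p * t ^ (p - 1) * δ t - a * β)
    (hδ_upper : ∃ K₁ : ℝ, 0 < K₁ ∧
      ∀ᶠ t in atTop, t * TikhonovHessian.timeDeriv t₀ δ t < K₁ * δ t)
    (x : ℝ → X) (hx : TikhonovHessian.IsGlobalSolution g α β a p q t₀ δ x) :
    ∃ (xbar : X) (xreg : ℝ → X),
      -- `xbar` is the unique minimum-norm minimizer of `g`
      (∀ z, TikhonovHessian.IsMinNormMinimizer g z ↔ z = xbar) ∧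
      -- `xreg t` is the unique minimizer of the regularized function `g_t`
      (∀ t, t₀ ≤ t → ∀ z,
        z ∈ TikhonovHessian.argmin (TikhonovHessian.regularized g a p δ t) ↔ z = xreg t) ∧
      -- strong convergence
      Tendsto (fun t => ‖x t - xbar‖) atTop (𝓝 0) ∧
      -- rates for `q < p < (3q+1)/2`
      (p < (3 * q + 1) / 2 →
        ((fun t => ‖TikhonovHessian.timeDeriv t₀ x t + β • gradient g (x t)‖)
            =O[atTop] fun t => 1 / t ^ ((p + 1 - max q (p - q)) / 2)) ∧
        ((fun t => ‖x t - xreg t‖) =O[atTop] fun t => 1 / t ^ ((1 - q) / 2)) ∧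
        ((fun t => g (x t) - g xbar) =O[atTop] fun t => 1 / (δ t * t ^ p))) ∧
      -- rates for `(3q+1)/2 ≤ p < q+1`
      ((3 * q + 1) / 2 ≤ p →
        ((fun t => ‖TikhonovHessian.timeDeriv t₀ x t + β • gradient g (x t)‖)
            =O[atTop] fun t => 1 / t ^ (2 * q - p + 1)) ∧
        ((fun t => ‖x t - xreg t‖) =O[atTop] fun t => 1 / t ^ (q - p + 1)) ∧
        (p ≤ (4 * q + 2) / 3 →
          (fun t => g (x t) - g xbar) =O[atTop] fun t => 1 / (δ t * t ^ p)) ∧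
        ((4 * q + 2) / 3 < p →
          (fun t => g (x t) - g xbar)
            =O[atTop] fun t => 1 / (δ t * t ^ (4 * q - 2 * p + 2)))) :=
  theorem3p4_general g hg_convex hg_diff hg_argmin α β a p q t₀ hα hβ ha ht₀ hq_lt hpq δ
    ⟨hδ_pos, hδ_diff, hδ_lower, hδ_upper.imp fun _ h => h.2⟩ x hx
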